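/- Let $T$ be a tree with $n\ge 3$ vertices and $p$ leaves (vertices of degree $1$), with degree function $d(\cdot)$ and distances $d_{x,y}$. Let $\mathrm{Max4PC}_T$ be the $\binom n2\times\binom n2$ real matrix with rows and columns indexed by the $2$-element subsets of $V(T)$ whose entry in row $\{w,x\}$ and column $\{y,z\}$ is $\max\{d_{w,x}+d_{y,z},\ d_{w,y}+d_{x,z},\ d_{w,z}+d_{x,y}\}$. The outputs $B$ of the following (nondeterministic) algorithm are sets of $2$-element subsets of $V(T)$. If $T$ is a star with centre $c$, the outputs are the sets $\{\{c,i\},\{j,k\}\}$ with $i,j,k$ leaves and $j\ne k$. If $T$ is not a star, let $G$ be the line graph $\mathrm{LG}(T)$ of $T$, whose vertices are the edges of $T$; let the starting vertex $s$ be any edge $\{a,b\}$ of $T$ with $a$ a leaf; and let $N=\emptyset$ (the set of next starting vertices) and $B=\emptyset$. Repeat the following. Let $C$ be the block of $G$ that contains $s$ (a block is a maximal connected subgraph without a cut vertex of its own). 1. If $C$ contains a cut vertex of $G$, choose such a cut vertex $c$. Add all other cut vertices of $G$ lying in $C$ to $N$. Add $s$ and the symmetric difference $s\triangle c$ to $B$.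 Replace $G$ by the graph obtained from it by removing all edges of $C$ and then deleting all vertices of $C$ that are not cut vertices of $G$. Put $s:=c$ and repeat. 2. If $C$ contains no cut vertex of $G$, choose a vertex $c\neq s$ of $C$. Add $s$ and $c$ to $B$, and delete all vertices of $C$ from $G$. If $N=\emptyset$, output $B$ and stop. Otherwise choose some $w\in N$, remove it from $N$, put $s:=w$ and repeat. Let $B$ be any output of this algorithm for $T$. Then: (a) If $T$ is not a star, there is a unique triple of vertices $(u,v,w)$ such that $\{u,v\},\{u,w\}\in B$, $d(u)=1$, $d(w)>1$, and both $\{u,v\}$ and $\{v,w\}$ are edges of $T$. (b) $|B|=2(n-p)$. (c) The rows of $\mathrm{Max4PC}_T$ indexed by $B$ form a basis of the row space of $\mathrm{Max4PC}_T$. (d) $\det \mathrm{Max4PC}_T[B,B]=(-1)^{n-p}\,2^{2(n-p-1)}$, where $\mathrm{Max4PC}_T[B,B]$ is the submatrix on the rows and columns indexed by $B$. -/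

import Mathlib

namespace Max4PC

/-- Unordered pairs of distinct elements of `V`, i.e. the 2-element subsets of `V`. -/
abbrev Pair (V : Type*) := {e : Sym2 V // ¬ e.IsDiag}

/-- The maximum 4PC matrix of `T`: the entry in row `{w,x}` and column `{y,z}` is the maximum of
`d(w,x) + d(y,z)`, `d(w,y) + d(x,z)` and `d(w,z) + d(x,y)`. -/
noncomputable def max4PC {V : Type*} (T : SimpleGraph V) : Matrix (Pair V) (Pair V) ℝ :=
  fun e f => Sym2.lift₂
    ⟨fun w x y z =>
      ((max (max (T.dist w x + T.dist y z) (T.dist w y + T.dist x z))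
        (T.dist w z + T.dist x y) : ℕ) : ℝ), by
      intro w x y z
      refine ⟨congrArg _ ?_, congrArg _ ?_⟩
      · rw [T.dist_comm (u := w) (v := x), max_right_comm, add_comm (T.dist w z),
          add_comm (T.dist w y)]
      · rw [T.dist_comm (u := y) (v := z), max_right_comm]⟩ e.1 f.1

/-- The number of leaves (vertices of degree one) of `T`. -/
def numLeaves {V : Type*} [Fintype V] (T : SimpleGraph V) [DecidableRel T.Adj] : ℕ :=
  (Finset.univ.filter fun v => T.degree v = 1).card

/-- `T` is a star. -/
def IsStar {V : Type*} (T : SimpleGraph V) : Prop := ∃ c, T = SimpleGraph.starGraph c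

/-- `v` is a cut vertex of the graph `H` (given as a subgraph of an ambient graph): deleting `v`
disconnects two other vertices that lie in the same component of `H`. -/
def IsCutVertex {W : Type*} {A : SimpleGraph W} (H : A.Subgraph) (v : W) : Prop :=
  v ∈ H.verts ∧ ∃ x y, x ≠ v ∧ y ≠ v ∧ H.spanningCoe.Reachable x y ∧
    ¬ (H.deleteVerts {v}).spanningCoe.Reachable x y

/-- A block of `H`: a maximal connected subgraph of `H` that has no cut vertex of its own. -/
def IsBlock {W : Type*} {A : SimpleGraph W} (H K : A.Subgraph) : Prop :=
  Maximal (fun K : A.Subgraph => K ≤ H ∧ K.Connected ∧ ∀ v, ¬ IsCutVertex K v) K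

/-- A vertex of the line graph of `T`, i.e. an edge of `T`, as a 2-element set of vertices. -/
def edgePair {V : Type*} {T : SimpleGraph V} (e : T.edgeSet) : Pair V :=
  ⟨e.1, T.not_isDiag_of_mem_edgeSet e.2⟩

/-- `AlgoReturns T G s N B O`: the algorithm, when it begins a round with current graph `G` (a
subgraph of the line graph of `T`), starting vertex `s`, next starting vertex set `N` and
partial output `B`, can terminate with output `O`. In each constructor `C` is the current block
and `c` the chosen vertex. -/
inductive AlgoReturns {V : Type*} (T : SimpleGraph V) :
    T.lineGraph.Subgraph → T.edgeSet → Set T.edgeSet → Set (Pair V) → Set (Pair V) → Prop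
  /-- The current block contains a cut vertex of `G`. One of them, `c`, is chosen, and the others
  are stored in the next starting vertex set. The edges of `C` and the vertices of `C` that are
  not cut vertices of `G` are deleted from `G`. The set `s` and the symmetric difference `d` of
  `s` and `c` are added to the output, and `c` becomes the starting vertex. -/
  | descend {G : T.lineGraph.Subgraph} {s : T.edgeSet} {N : Set T.edgeSet}
      {B O : Set (Pair V)} (C : T.lineGraph.Subgraph) (c : T.edgeSet) (d : Pair V)
      (hC : IsBlock G C) (hs : s ∈ C.verts)
      (hc : c ∈ C.verts) (hcut : IsCutVertex G c)
      (hd : (d.1 : Set V) = symmDiff (s.1 : Set V) (c.1 : Set V))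
      (hO : AlgoReturns T
        ((G.deleteEdges C.edgeSet).deleteVerts {x | x ∈ C.verts ∧ ¬ IsCutVertex G x})
        c
        (N ∪ {x | x ∈ C.verts ∧ IsCutVertex G x ∧ x ≠ c})
        (B ∪ {edgePair s, d}) O) :
      AlgoReturns T G s N B O
  /-- The current block contains no cut vertex of `G`. Any vertex `c ≠ s` of it is chosen, `s` and
  `c` are added to the output and the vertices of the block are deleted from `G`. An element `w`
  of the next starting vertex set is removed from that set and becomes the starting vertex. -/
  | backtrack {G : T.lineGraph.Subgraph} {s : T.edgeSet} {N : Set T.edgeSet}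
      {B O : Set (Pair V)} (C : T.lineGraph.Subgraph) (c w : T.edgeSet)
      (hC : IsBlock G C) (hs : s ∈ C.verts)
      (hcut : ∀ x ∈ C.verts, ¬ IsCutVertex G x)
      (hc : c ∈ C.verts) (hcs : c ≠ s) (hw : w ∈ N)
      (hO : AlgoReturns T (G.deleteVerts C.verts) w (N \ {w})
        (B ∪ {edgePair s, edgePair c}) O) :
      AlgoReturns T G s N B O
  /-- As in `backtrack`, but the next starting vertex set is empty: output and terminate. -/
  | halt {G : T.lineGraph.Subgraph} {s : T.edgeSet} {B : Set (Pair V)}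
      (C : T.lineGraph.Subgraph) (c : T.edgeSet)
      (hC : IsBlock G C) (hs : s ∈ C.verts)
      (hcut : ∀ x ∈ C.verts, ¬ IsCutVertex G x)
      (hc : c ∈ C.verts) (hcs : c ≠ s) :
      AlgoReturns T G s ∅ B (B ∪ {edgePair s, edgePair c})

/-- `B` is a possible output of the algorithm for the tree `T`.
For a star with centre `c` the outputs are the sets `{{c,i},{j,k}}` with `i, j, k` leaves and
`j ≠ k`. For a non-star tree the algorithm is run on the whole line graph, with a pendant edge of
`T` as starting vertex, an empty next starting vertex set and an empty partial output. -/
def IsOutput {V : Type*} [Fintype V] (T : SimpleGraph V) [DecidableRel T.Adj]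
    (B : Set (Pair V)) : Prop :=
  (∃ c i j k : V, T = SimpleGraph.starGraph c ∧
    ∃ (hci : c ≠ i) (_ : c ≠ j) (_ : c ≠ k) (hjk : j ≠ k),
      B = {⟨s(c, i), by simpa using hci⟩, ⟨s(j, k), by simpa using hjk⟩}) ∨
  (¬ IsStar T ∧ ∃ s : T.edgeSet, (∃ p ∈ s.1, T.degree p = 1) ∧ AlgoReturns T ⊤ s ∅ ∅ B)

end Max4PC

/-! Root `T` at a leaf `a` with neighbour `b`: the leaf of the starting edge, or in a star the leaf
`i` of the pair `{c, i}`. The distance of two vertices is the number of non-root vertices lying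
above exactly one of them. For four points the sets lying below the various vertices form a laminar
family, so one pairing attains the vertexwise optimum everywhere. Hence the entry at `(S, S')` is
the total depth of `S` and `S'` minus twice the sum over `v` of `touches S v * covers S' v + covers
S v * touches S' v`.

A leaf other than the root covers no pair, so only the `m = n - p` inner vertices matter. Every pair
touches `b`, so the depths can be absorbed into the covering coordinate at `b`. The matrix thus
becomes an integral Gram matrix `F D Fᵀ` (`max4PC_eq_feature`), where `D` is a sum of `m` hyperbolic
planes with coefficient `1` at `b` and `-2` elsewhere, and has determinant `(-1)^m 2^(2(m-1))`. If
the features of the pairs in `B` generate the lattice `ℤ^(2m)`, then they form a unimodular matrix,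
and size, basis property and determinant all follow (`conclusions_of_span_eq_top`).

It remains to know `B`. During a run the current graph is the union of the cliques at a set `R` of
inner vertices, its cut vertices are the edges with both ends in `R`, and each round removes the
topmost vertex `v` of `R` to which the starting edge leads. So the output consists of the parent
edge of each inner `v` and one second pair: the parent of `v` with an inner child of `v`, or `v`
with a child if no child is inner (`output_eq`). Differences of the features of such pairs give all
unit vectors, and the same description yields the unique triple. -/

namespace Max4PC

/-! ### Rooted trees and the distance formula -/

section

open SimpleGraph Finset

variable {V : Type*}

/-- `par` is the parent map of the tree `T` rooted at `a`. -/
structure IsParent (T : SimpleGraph V) (a : V) (par : V → V) : Prop where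
  root : par a = a
  adj : ∀ v, v ≠ a → T.Adj (par v) v
  dist : ∀ v, v ≠ a → T.dist a v = T.dist a (par v) + 1
  eq_of_adj : ∀ u v, T.Adj u v → (v ≠ a ∧ u = par v) ∨ (u ≠ a ∧ v = par u)

/-- Two geodesics from `a` to `v`, through `u` and through `w`, are paths in a tree, so they
coincide and share their penultimate vertex. This makes parents unique. -/
lemma eq_of_adj_of_dist_eq {T : SimpleGraph V} (hT : T.IsTree) {a u w v : V}
    (hu : T.Adj u v) (hw : T.Adj w v) (hdu : T.dist a v = T.dist a u + 1)
    (hdw : T.dist a v = T.dist a w + 1) : u = w := by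
  obtain ⟨p, hp⟩ := hT.1.exists_walk_length_eq_dist a u
  obtain ⟨q, hq⟩ := hT.1.exists_walk_length_eq_dist a w
  have h1 : (p.concat hu).IsPath := Walk.isPath_of_length_eq_dist _ (by simp [hp, hdu])
  have h2 : (q.concat hw).IsPath := Walk.isPath_of_length_eq_dist _ (by simp [hq, hdw])
  have h := (hT.existsUnique_path a v).unique h1 h2
  simpa using congrArg Walk.penultimate h

lemma exists_isParent {T : SimpleGraph V} (hT : T.IsTree) (a : V) : ∃ par, IsParent T a par := by
  classical
  have key : ∀ v, ∃ u, (v = a → u = a) ∧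
      (v ≠ a → T.Adj u v ∧ T.dist a v = T.dist a u + 1) := by
    intro v
    by_cases hv : v = a
    · exact ⟨a, by simp [hv]⟩
    · obtain ⟨p, hp⟩ := hT.1.exists_walk_length_eq_dist a v
      have hn : ¬ p.Nil := fun h => hv h.eq.symm
      have hadj := p.adj_penultimate hn
      refine ⟨p.penultimate, fun h => absurd h hv, fun _ => ⟨hadj, ?_⟩⟩
      rcases hT.dist_eq_dist_add_one_of_adj a hadj with h | h
      · have h3 : T.dist a p.penultimate ≤ p.dropLast.length := dist_le _
        have h4 : p.dropLast.length + 1 = p.length := Walk.length_dropLast_add_one hn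
        omega
      · exact h
  choose par h0 h1 using key
  refine ⟨par, h0 a rfl, fun v hv => (h1 v hv).1, fun v hv => (h1 v hv).2, fun u v huv => ?_⟩
  rcases hT.dist_eq_dist_add_one_of_adj a huv with h | h
  · right
    have hu : u ≠ a := by rintro rfl; simp at h
    exact ⟨hu, eq_of_adj_of_dist_eq hT huv.symm (h1 u hu).1 h (h1 u hu).2⟩
  · left
    have hv : v ≠ a := by rintro rfl; simp at h
    exact ⟨hv, eq_of_adj_of_dist_eq hT huv (h1 v hv).1 h (h1 v hv).2⟩

/-- `u` is an ancestor of `v` (possibly `v` itself) with respect to the parent map `par`. -/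
def Anc (par : V → V) (u v : V) : Prop := ∃ k, par^[k] v = u

lemma Anc.refl (par : V → V) (v : V) : Anc par v v := ⟨0, rfl⟩

lemma anc_par {par : V → V} (v : V) : Anc par (par v) v := ⟨1, rfl⟩

lemma anc_iff {par : V → V} {u v : V} : Anc par u v ↔ u = v ∨ Anc par u (par v) := by
  constructor
  · rintro ⟨k, rfl⟩
    cases k with
    | zero => exact Or.inl rfl
    | succ k => exact Or.inr ⟨k, rfl⟩
  · rintro (rfl | ⟨k, rfl⟩)
    · exact Anc.refl _ _
    · exact ⟨k + 1, rfl⟩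

lemma Anc.trans {par : V → V} {u v w : V} (h : Anc par u v) (h' : Anc par v w) :
    Anc par u w := by
  obtain ⟨k, rfl⟩ := h
  obtain ⟨l, rfl⟩ := h'
  exact ⟨k + l, Function.iterate_add_apply par k l w⟩

lemma Anc.total {par : V → V} {u v w : V} (h : Anc par u w) (h' : Anc par v w) :
    Anc par u v ∨ Anc par v u := by
  obtain ⟨k, rfl⟩ := h
  obtain ⟨l, rfl⟩ := h'
  rcases le_total k l with hkl | hkl
  · exact Or.inr ⟨l - k, by rw [← Function.iterate_add_apply, Nat.sub_add_cancel hkl]⟩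
  · exact Or.inl ⟨k - l, by rw [← Function.iterate_add_apply, Nat.sub_add_cancel hkl]⟩

namespace IsParent

variable {T : SimpleGraph V} {a : V} {par : V → V}

lemma dist_par_lt (h : IsParent T a par) {v : V} (hv : v ≠ a) :
    T.dist a (par v) < T.dist a v := by
  have := h.dist v hv
  omega

lemma dist_le_of_anc (h : IsParent T a par) {u v : V} (huv : Anc par u v) :
    T.dist a u ≤ T.dist a v := by
  obtain ⟨k, rfl⟩ := huv
  induction k with
  | zero => rfl
  | succ k ih =>
    rw [Function.iterate_succ_apply']
    by_cases hk : par^[k] v = a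
    · rw [hk, h.root]; simp
    · exact (h.dist_par_lt hk).le.trans ih

lemma not_anc_par (h : IsParent T a par) {v : V} (hv : v ≠ a) : ¬ Anc par v (par v) := by
  intro hh
  have h1 := h.dist_le_of_anc hh
  have h2 := h.dist_par_lt hv
  omega

lemma anc_antisymm (h : IsParent T a par) {u v : V} (huv : Anc par u v) (hvu : Anc par v u) :
    u = v := by
  by_contra hne
  have h1 := (anc_iff.1 huv).resolve_left hne
  by_cases hv : v = a
  · subst hv
    obtain ⟨k, hk⟩ := huv
    rw [Function.iterate_fixed h.root] at hk
    exact hne hk.symm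
  · exact h.not_anc_par hv (hvu.trans h1)

lemma anc_root (h : IsParent T a par) {u : V} : Anc par u a ↔ u = a := by
  constructor
  · rintro ⟨k, rfl⟩
    exact Function.iterate_fixed h.root k
  · rintro rfl
    exact Anc.refl _ _

/-- Induction from the root towards the leaves. -/
lemma induction (h : IsParent T a par) {P : V → Prop} (root : P a)
    (step : ∀ v, v ≠ a → P (par v) → P v) (v : V) : P v := by
  induction hk : T.dist a v using Nat.strong_induction_on generalizing v with
  | _ k ih =>
    by_cases hv : v = a
    · exact hv ▸ root
    · exact step v hv (ih _ (hk ▸ h.dist_par_lt hv) _ rfl)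

lemma root_anc (h : IsParent T a par) (v : V) : Anc par a v :=
  h.induction (P := fun v => Anc par a v) (Anc.refl _ _) (fun _ _ ih => anc_iff.2 (Or.inr ih)) v

open Classical in
/-- The indicator of the set of vertices `v` other than the root such that `x` lies below `v`. -/
noncomputable def below (a : V) (par : V → V) (x v : V) : ℤ :=
  if v ≠ a ∧ Anc par v x then 1 else 0

lemma below_root (h : IsParent T a par) (v : V) : below a par a v = 0 := by
  unfold below
  rw [if_neg]
  rintro ⟨h1, h2⟩
  exact h1 (h.anc_root.1 h2)

open Classical in
lemma below_eq_add (h : IsParent T a par) {x : V} (hx : x ≠ a) (v : V) :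
    below a par x v = (if v = x then 1 else 0) + below a par (par x) v := by
  unfold below
  by_cases hv : v = x
  · subst hv
    simp [hx, Anc.refl, h.not_anc_par hx]
  · have := @anc_iff _ par v x
    simp [hv, this]

lemma below_mul_self (x v : V) : below a par x v * below a par x v = below a par x v := by
  unfold below; split_ifs <;> simp

/-- The ancestors of a common vertex form a chain, so two subtrees that meet are nested. -/
lemma below_laminar {u v x : V} (hu : below a par x u = 1) (hv : below a par x v = 1) :
    (∀ y, below a par y v ≤ below a par y u) ∨ (∀ y, below a par y u ≤ below a par y v) := by
  have key : ∀ {x v}, below a par x v = 1 ↔ v ≠ a ∧ Anc par v x := by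
    intro x v
    unfold below
    split_ifs with h <;> simp [h]
  have mono : ∀ {u v}, u ≠ a → Anc par u v → ∀ y, below a par y v ≤ below a par y u := by
    intro u v hu huv y
    by_cases h : v ≠ a ∧ Anc par v y
    · simp [below, h, hu, huv.trans h.2]
    · rw [below, if_neg h]
      unfold below
      split_ifs <;> simp
  obtain ⟨hu1, hu2⟩ := key.1 hu
  obtain ⟨hv1, hv2⟩ := key.1 hv
  rcases hu2.total hv2 with h | h
  · exact Or.inl (mono hu1 h)
  · exact Or.inr (mono hv1 h)

variable [Fintype V]

/-- The number of vertices other than the root that separate exactly one of `x`, `y` from it. -/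
noncomputable def treeDist (a : V) (par : V → V) (x y : V) : ℤ :=
  ∑ v, (below a par x v + below a par y v - 2 * (below a par x v * below a par y v))

lemma treeDist_comm (x y : V) : treeDist a par x y = treeDist a par y x := by
  unfold treeDist
  exact Finset.sum_congr rfl fun v _ => by ring

lemma treeDist_self (x : V) : treeDist a par x x = 0 := by
  unfold treeDist
  exact Finset.sum_eq_zero fun v _ => by rw [below_mul_self]; ring

/-- Passing from `x` to its parent alters only the summand at `x` itself. -/
lemma treeDist_eq_add (h : IsParent T a par) {x : V} (hx : x ≠ a) (y : V) :
    treeDist a par x y = treeDist a par (par x) y + 1 - 2 * below a par y x := by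
  classical
  have : ∀ v, below a par x v + below a par y v - 2 * (below a par x v * below a par y v) =
      (below a par (par x) v + below a par y v - 2 * (below a par (par x) v * below a par y v)) +
      (if v = x then 1 - 2 * below a par y x else 0) := by
    intro v
    rw [h.below_eq_add hx]
    split_ifs with hv
    · subst hv; ring
    · ring
  unfold treeDist
  rw [Finset.sum_congr rfl fun v _ => this v, Finset.sum_add_distrib]
  simp
  ring

lemma treeDist_le_of_adj (h : IsParent T a par) {x x' : V} (hadj : T.Adj x x') (y : V) :
    treeDist a par x y ≤ treeDist a par x' y + 1 := by
  have hb : ∀ v, below a par y v = 0 ∨ below a par y v = 1 := fun v => by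
    unfold below; split_ifs <;> simp
  rcases h.eq_of_adj _ _ hadj with ⟨hx, rfl⟩ | ⟨hx, rfl⟩
  · have := h.treeDist_eq_add hx y
    rcases hb x' with h0 | h0 <;> rw [h0] at this <;> linarith
  · have := h.treeDist_eq_add hx y
    rcases hb x with h0 | h0 <;> rw [h0] at this <;> linarith

lemma treeDist_le_length (h : IsParent T a par) {x y : V} (p : T.Walk x y) :
    treeDist a par x y ≤ p.length := by
  induction p with
  | nil => simp [treeDist_self]
  | cons hadj p ih =>
    have := h.treeDist_le_of_adj hadj
    simp only [Walk.length_cons, Nat.cast_add, Nat.cast_one]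
    exact (this _).trans (by linarith)

/-- Of two distinct vertices one is not above the other. Moving that one to its parent lowers the
formula by exactly one, while the distance drops by at most one. -/
lemma dist_le_treeDist (h : IsParent T a par) (hT : T.Connected) (x y : V) :
    (T.dist x y : ℤ) ≤ treeDist a par x y := by
  have step : ∀ x y : V, x ≠ a → ¬ Anc par x y →
      (T.dist (par x) y : ℤ) ≤ treeDist a par (par x) y →
      (T.dist x y : ℤ) ≤ treeDist a par x y := by
    intro x y hx hxy hle
    rw [h.treeDist_eq_add hx]
    have h0 : below a par y x = 0 := by simp [below, hxy]
    have h1 : T.dist x y ≤ T.dist x (par x) + T.dist (par x) y := hT.dist_triangle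
    have h2 : T.dist x (par x) = 1 := dist_eq_one_iff_adj.2 (h.adj x hx).symm
    rw [h0]
    zify at h1 h2
    linarith
  induction hk : T.dist a x + T.dist a y using Nat.strong_induction_on generalizing x y with
  | _ k ih =>
    by_cases hxy : x = y
    · subst hxy; simp [treeDist_self]
    by_cases h1 : Anc par x y
    · have h2 : ¬ Anc par y x := fun h2 => hxy (h.anc_antisymm h1 h2)
      have hy : y ≠ a := fun hy => h2 (hy ▸ h.root_anc x)
      rw [dist_comm, treeDist_comm]
      refine step y x hy h2 ?_
      refine ih _ ?_ _ _ rfl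
      have := h.dist_par_lt hy
      omega
    · have hx : x ≠ a := fun hx => h1 (hx ▸ h.root_anc y)
      refine step x y hx h1 (ih _ ?_ _ _ rfl)
      have := h.dist_par_lt hx
      omega

lemma dist_eq_treeDist (h : IsParent T a par) (hT : T.Connected) (x y : V) :
    (T.dist x y : ℤ) = treeDist a par x y := by
  refine le_antisymm (h.dist_le_treeDist hT x y) ?_
  obtain ⟨p, hp⟩ := hT.exists_walk_length_eq_dist x y
  rw [← hp]
  exact h.treeDist_le_length p

lemma dist_root_eq_sum (h : IsParent T a par) (hT : T.Connected) (x : V) :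
    (T.dist a x : ℤ) = ∑ v, below a par x v := by
  rw [h.dist_eq_treeDist hT, treeDist]
  exact Finset.sum_congr rfl fun v _ => by rw [h.below_root]; ring

end IsParent

end

/-! ### Integral Gram factorisations and unimodular changes of coordinates -/

section

open SimpleGraph Finset

section LinearAlgebra

variable {ι κ : Type*} [Fintype κ] {F : ι → κ → ℤ} {r : κ → ι} {M : Matrix ι ι ℝ}
  {D : Matrix κ κ ℤ}

lemma span_row_of_span_eq_top
    (hM : ∀ i j, M i j = (F i ⬝ᵥ D.mulVec (F j) : ℤ))
    (h : Submodule.span ℤ (Set.range fun k => F (r k)) = ⊤) :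
    Submodule.span ℝ (Set.range fun k => M.row (r k)) = Submodule.span ℝ (Set.range M.row) := by
  refine le_antisymm (Submodule.span_mono ?_) (Submodule.span_le.2 ?_)
  · rintro _ ⟨k, rfl⟩
    exact ⟨r k, rfl⟩
  · rintro _ ⟨i, rfl⟩
    obtain ⟨c, hc⟩ := (Submodule.mem_span_range_iff_exists_fun ℤ).1
      (h ▸ Submodule.mem_top : F i ∈ Submodule.span ℤ (Set.range fun k => F (r k)))
    refine (Submodule.mem_span_range_iff_exists_fun ℝ).2 ⟨fun k => (c k : ℝ), ?_⟩
    ext j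
    simp only [Finset.sum_apply, Pi.smul_apply, smul_eq_mul, Matrix.row_apply, hM]
    rw [← hc, sum_dotProduct, Int.cast_sum]
    refine Finset.sum_congr rfl fun k _ => ?_
    rw [smul_dotProduct, smul_eq_mul, Int.cast_mul]

variable [DecidableEq κ]

lemma det_fromBlocks_zero_diagonal (m : Type*) [Fintype m] [DecidableEq m] (c : m → ℤ) :
    (Matrix.fromBlocks 0 (Matrix.diagonal c) (Matrix.diagonal c) 0).det =
      (-1) ^ Fintype.card m * (∏ i, c i) ^ 2 := by
  let I : Matrix m m ℤ := 1
  have h1 : (Matrix.fromBlocks 0 I I 0).det = (-1) ^ Fintype.card m := by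
    -- The unipotent factor has determinant one and puts an identity in the top left corner, so that
    -- the Schur complement `-I` gives the sign.
    have : Matrix.fromBlocks I I 0 I * Matrix.fromBlocks 0 I I 0 = Matrix.fromBlocks 1 I I 0 := by
      simp [Matrix.fromBlocks_multiply, I]
    have h2 := congrArg Matrix.det this
    rw [Matrix.det_mul, Matrix.det_fromBlocks_zero₂₁, Matrix.det_fromBlocks_one₁₁] at h2
    simpa [Matrix.det_neg, I] using h2
  have h3 : Matrix.fromBlocks 0 (Matrix.diagonal c) (Matrix.diagonal c) 0 =
      Matrix.fromBlocks (Matrix.diagonal c) 0 0 (Matrix.diagonal c) *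
        Matrix.fromBlocks 0 I I 0 := by
    rw [Matrix.fromBlocks_multiply]
    simp [I]
  rw [h3, Matrix.det_mul, h1, Matrix.det_fromBlocks_zero₂₁, Matrix.det_diagonal]
  ring

/-- Rows generating the lattice provide an integral left inverse, so the determinant is a unit of
`ℤ`. -/
lemma det_mul_self_of_span_eq_top {K : Matrix κ κ ℤ}
    (h : Submodule.span ℤ (Set.range K) = ⊤) : K.det * K.det = 1 := by
  have hex : ∀ i, ∃ c : κ → ℤ, ∑ k, c k • K k = Pi.single i 1 := fun i =>
    (Submodule.mem_span_range_iff_exists_fun ℤ).1 (h ▸ Submodule.mem_top)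
  choose c hc using hex
  have hmul : (Matrix.of c) * K = 1 := by
    ext i j
    have := congrFun (hc i) j
    simp only [Finset.sum_apply, Pi.smul_apply, smul_eq_mul] at this
    rw [Matrix.mul_apply, Matrix.one_apply]
    simpa [Pi.single_apply, eq_comm] using this
  have hdet := congrArg Matrix.det hmul
  rw [Matrix.det_mul, Matrix.det_one] at hdet
  exact Int.isUnit_mul_self (IsUnit.of_mul_eq_one _ ((mul_comm _ _).trans hdet))

lemma det_submatrix_of_span_eq_top (hM : ∀ i j, M i j = (F i ⬝ᵥ D.mulVec (F j) : ℤ))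
    (h : Submodule.span ℤ (Set.range fun k => F (r k)) = ⊤) :
    (M.submatrix r r).det = D.det := by
  set K : Matrix κ κ ℤ := fun k => F (r k) with hK
  have h1 : M.submatrix r r = (Int.castRingHom ℝ).mapMatrix (K * (D * K.transpose)) := by
    ext i j
    simp only [Matrix.submatrix_apply, hM, RingHom.mapMatrix_apply, Matrix.map_apply]
    rfl
  rw [h1, ← RingHom.map_det, Matrix.det_mul, Matrix.det_mul, Matrix.det_transpose]
  have := det_mul_self_of_span_eq_top (K := K) h
  simp only [eq_intCast, Int.cast_inj]
  linear_combination D.det * this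

lemma injective_of_span_eq_top (h : Submodule.span ℤ (Set.range fun k => F (r k)) = ⊤) :
    Function.Injective r := by
  intro k l hkl
  by_contra hne
  have := det_mul_self_of_span_eq_top (K := fun k => F (r k)) h
  have h0 : Matrix.det (fun k => F (r k)) = 0 :=
    Matrix.det_zero_of_row_eq hne (congrArg F hkl)
  simp [h0] at this

lemma linearIndependent_row_of_span_eq_top
    (hM : ∀ i j, M i j = (F i ⬝ᵥ D.mulVec (F j) : ℤ)) (hD : D.det ≠ 0)
    (h : Submodule.span ℤ (Set.range fun k => F (r k)) = ⊤) :
    LinearIndependent ℝ fun k => M.row (r k) := by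
  have h1 : (M.submatrix r r).det ≠ 0 := by
    rw [det_submatrix_of_span_eq_top hM h]
    exact_mod_cast hD
  have h2 := Matrix.linearIndependent_rows_of_det_ne_zero h1
  exact LinearIndependent.of_comp (LinearMap.funLeft ℝ ℝ r) h2

end LinearAlgebra

variable {V : Type*}

/-! ### The maximum of the three pairings as a sum over vertices -/

namespace IsParent

variable {T : SimpleGraph V} {a b : V} {par : V → V}

lemma below_eq_zero_or_one (a : V) (par : V → V) (x v : V) :
    below a par x v = 0 ∨ below a par x v = 1 := by
  unfold below; split_ifs <;> simp

lemma max_dist_add_dist [Fintype V] (h : IsParent T a par) (hT : T.Connected) (w x y z : V) :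
    ((max (max (T.dist w x + T.dist y z) (T.dist w y + T.dist x z))
        (T.dist w z + T.dist x y) : ℕ) : ℤ) =
      T.dist a w + T.dist a x + (T.dist a y + T.dist a z) - 2 * ∑ v,
        ((below a par w v + below a par x v - below a par w v * below a par x v) *
            (below a par y v * below a par z v) +
          below a par w v * below a par x v *
            (below a par y v + below a par z v - below a par y v * below a par z v)) := by
  set i := below a par with hi
  have h01 := below_eq_zero_or_one a par
  -- If `k` of the four points lie below `v`, then `s v = max (k - 2) 0`; in particular it does not
  -- depend on the pairing.
  set s : V → ℤ := fun v => (i w v + i x v - i w v * i x v) * (i y v * i z v) +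
    i w v * i x v * (i y v + i z v - i y v * i z v) with hs
  -- The loss of a pairing at `v`: it is `1` if the points below `v` are exactly one of the two
  -- pairs, and `0` otherwise.
  set f : V → V → V → V → V → ℤ := fun w x y z v => i w v * i x v + i y v * i z v - s v with hf
  have hexp : ∀ w' x' y' z' : V, (T.dist w' x' : ℤ) + T.dist y' z' =
      T.dist a w' + T.dist a x' + (T.dist a y' + T.dist a z') - 2 * ∑ v, s v -
        2 * ∑ v, f w' x' y' z' v := by
    intro w' x' y' z'
    rw [h.dist_eq_treeDist hT w', h.dist_eq_treeDist hT y', h.dist_root_eq_sum hT w',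
      h.dist_root_eq_sum hT x', h.dist_root_eq_sum hT y', h.dist_root_eq_sum hT z']
    simp only [treeDist, Finset.mul_sum, ← Finset.sum_add_distrib, ← Finset.sum_sub_distrib]
    refine Finset.sum_congr rfl fun v _ => ?_
    simp only [hf]
    ring
  have hnn : ∀ v, 0 ≤ f w x y z v ∧ 0 ≤ f w y x z v ∧ 0 ≤ f w z x y v := by
    intro v
    simp only [hf, hs]
    rcases h01 w v with h1 | h1 <;> rcases h01 x v with h2 | h2 <;> rcases h01 y v with h3 | h3 <;>
      rcases h01 z v with h4 | h4 <;> simp [hi, h1, h2, h3, h4]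
  -- If two pairings both had a loss, at `u` and at `v`, the two-point sets below `u` and `v` would
  -- meet in one point without being nested, against laminarity. So one of these two pairings is
  -- lossless and attains the maximum.
  have hzero : (∀ v, f w x y z v = 0) ∨ (∀ v, f w y x z v = 0) := by
    by_contra hcon
    push Not at hcon
    obtain ⟨⟨u, hu⟩, ⟨v, hv⟩⟩ := hcon
    have hlam : ∀ t, i t u = 1 → i t v = 1 →
        (∀ y, i y v ≤ i y u) ∨ (∀ y, i y u ≤ i y v) := fun t => below_laminar
    have hw := hlam w
    have hx := hlam x
    have hy := hlam y
    have hz := hlam z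
    clear hlam
    simp only [hf, hs] at hu hv
    rcases h01 w u with h1 | h1 <;> rcases h01 x u with h2 | h2 <;> rcases h01 y u with h3 | h3 <;>
      rcases h01 z u with h4 | h4 <;> simp [hi, h1, h2, h3, h4] at hu <;>
    rcases h01 w v with h5 | h5 <;> rcases h01 x v with h6 | h6 <;> rcases h01 y v with h7 | h7 <;>
      rcases h01 z v with h8 | h8 <;> simp [hi, h5, h6, h7, h8] at hv <;>
    simp only [hi, h1, h2, h3, h4, h5, h6, h7, h8, forall_true_left] at hw hx hy hz
    all_goals
      first
      | (rcases hw with hh | hh <;> linarith [hh w, hh x, hh y, hh z])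
      | (rcases hx with hh | hh <;> linarith [hh w, hh x, hh y, hh z])
      | (rcases hy with hh | hh <;> linarith [hh w, hh x, hh y, hh z])
      | (rcases hz with hh | hh <;> linarith [hh w, hh x, hh y, hh z])
  push_cast
  rw [hexp w x y z, hexp w y x z, hexp w z x y]
  have e1 := Finset.sum_nonneg fun v (_ : v ∈ Finset.univ) => (hnn v).1
  have e2 := Finset.sum_nonneg fun v (_ : v ∈ Finset.univ) => (hnn v).2.1
  have e3 := Finset.sum_nonneg fun v (_ : v ∈ Finset.univ) => (hnn v).2.2
  apply le_antisymm
  · refine max_le (max_le ?_ ?_) ?_ <;> linarith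
  · rcases hzero with h0 | h0
    · refine le_trans ?_ ((le_max_left _ _).trans (le_max_left _ _))
      rw [Finset.sum_eq_zero fun v _ => h0 v]
      linarith
    · refine le_trans ?_ ((le_max_right _ _).trans (le_max_left _ _))
      rw [Finset.sum_eq_zero fun v _ => h0 v]
      linarith

end IsParent

end

/-! ### Feature vectors and the factorisation of the matrix -/

section

open SimpleGraph Finset

variable {V : Type*}

/-- The vertices of degree at least two. -/
abbrev Inner [Fintype V] (T : SimpleGraph V) [DecidableRel T.Adj] := {v : V // 1 < T.degree v}

open Classical in
/-- The indicator of the event that some element of `S` lies below `v`. -/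
noncomputable def touches (par : V → V) (S : Pair V) (v : V) : ℤ :=
  if ∃ x ∈ S.1, Anc par v x then 1 else 0

open Classical in
/-- The indicator of the event that all elements of `S` lie below `v`. -/
noncomputable def covers (par : V → V) (S : Pair V) (v : V) : ℤ :=
  if ∀ x ∈ S.1, Anc par v x then 1 else 0

/-- The sum of the distances from `a` to the elements of `S`. -/
noncomputable def totalDepth (T : SimpleGraph V) (a : V) (S : Pair V) : ℤ :=
  Sym2.lift ⟨fun x y => (T.dist a x : ℤ) + T.dist a y, fun _ _ => add_comm _ _⟩ S.1

/-- The coordinates of a pair in which `max4PC T` becomes a sum of hyperbolic planes. -/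
noncomputable def feature [Fintype V] [DecidableEq V] (T : SimpleGraph V) [DecidableRel T.Adj]
    (a b : V) (par : V → V) (S : Pair V) : Inner T ⊕ Inner T → ℤ
  | .inl v => touches par S v
  | .inr v => if v.1 = b then totalDepth T a S - 2 * covers par S v else covers par S v

/-- The coefficients of the hyperbolic planes. -/
def planeCoeff [Fintype V] [DecidableEq V] (T : SimpleGraph V) [DecidableRel T.Adj]
    (b : V) (v : Inner T) : ℤ := if v.1 = b then 1 else -2

section

variable {par : V → V} {x y v : V} {hxy : ¬ s(x, y).IsDiag}

open Classical in
lemma touches_mk : touches par ⟨s(x, y), hxy⟩ v = if Anc par v x ∨ Anc par v y then 1 else 0 := by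
  simp [touches]

open Classical in
lemma covers_mk : covers par ⟨s(x, y), hxy⟩ v = if Anc par v x ∧ Anc par v y then 1 else 0 := by
  simp [covers]

lemma totalDepth_mk {T : SimpleGraph V} {a : V} :
    totalDepth T a ⟨s(x, y), hxy⟩ = T.dist a x + T.dist a y := rfl

lemma touches_mk_eq_below {a : V} (hv : v ≠ a) : touches par ⟨s(x, y), hxy⟩ v =
    IsParent.below a par x v + IsParent.below a par y v -
      IsParent.below a par x v * IsParent.below a par y v := by
  rw [touches_mk]
  unfold IsParent.below
  by_cases h1 : Anc par v x <;> by_cases h2 : Anc par v y <;> simp [h1, h2, hv]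

lemma covers_mk_eq_below {a : V} (hv : v ≠ a) : covers par ⟨s(x, y), hxy⟩ v =
    IsParent.below a par x v * IsParent.below a par y v := by
  rw [covers_mk]
  unfold IsParent.below
  by_cases h1 : Anc par v x <;> by_cases h2 : Anc par v y <;> simp [h1, h2, hv]

end

namespace IsParent

variable {T : SimpleGraph V} {a b : V} {par : V → V}

lemma anc_child (h : IsParent T a par) (hb : ∀ x, T.Adj a x → x = b) {x : V} (hx : x ≠ a) :
    Anc par b x := by
  refine h.induction (P := fun x => x ≠ a → Anc par b x) (fun h => absurd rfl h) ?_ x hx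
  intro v hv ih _
  by_cases hp : par v = a
  · have := hb v (hp ▸ h.adj v hv)
    rw [this]
    exact Anc.refl _ _
  · exact anc_iff.2 (Or.inr (ih hp))

/-- A pair has an element other than the root, and all such vertices lie below the only child of the
root. This constant coordinate is what lets the depths enter the bilinear form. -/
lemma touches_child (h : IsParent T a par) (hb : ∀ x, T.Adj a x → x = b) (S : Pair V) :
    touches par S b = 1 := by
  obtain ⟨⟨x, y⟩, hxy⟩ := S
  have hne : x ≠ y := by simpa using hxy
  change touches par ⟨s(x, y), hxy⟩ b = 1
  rw [touches_mk, if_pos]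
  by_cases hx : x = a
  · exact Or.inr (h.anc_child hb (hx ▸ hne.symm))
  · exact Or.inl (h.anc_child hb hx)

variable [Fintype V] [DecidableRel T.Adj]

lemma not_inner_iff (hT : T.Connected) [Nontrivial V] (v : V) :
    ¬ 1 < T.degree v ↔ T.degree v = 1 := by
  have := hT.preconnected.degree_pos_of_nontrivial v
  omega

lemma eq_of_degree_eq_one {v x y : V} (hv : T.degree v = 1) (hx : T.Adj v x) (hy : T.Adj v y) :
    x = y := by
  rw [← T.mem_neighborFinset] at hx hy
  exact Finset.card_le_one.1 hv.le x hx y hy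

lemma degree_par (h : IsParent T a par) {v : V} (hv : v ≠ a) (hp : par v ≠ a) :
    1 < T.degree (par v) := by
  refine Finset.one_lt_card.2 ⟨v, ?_, par (par v), ?_, ?_⟩
  · simpa using h.adj v hv
  · simpa using (h.adj _ hp).symm
  · intro he
    have h1 := h.dist v hv
    have h2 := h.dist _ hp
    rw [← he] at h2
    omega

lemma eq_of_anc_of_degree_eq_one (h : IsParent T a par) {v x : V} (hva : v ≠ a)
    (hv : T.degree v = 1) (hvx : Anc par v x) : v = x := by
  revert hvx
  refine h.induction (P := fun x => Anc par v x → v = x) (fun hvx => h.anc_root.1 hvx) ?_ x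
  intro x hx ih hvx
  rcases anc_iff.1 hvx with h1 | h1
  · exact h1
  · have h2 := ih h1
    have h3 := h.degree_par hx (h2 ▸ hva)
    rw [← h2] at h3
    omega

variable [DecidableEq V]

lemma max4PC_eq_feature (h : IsParent T a par) (hT : T.Connected) [Nontrivial V]
    (ha : T.degree a = 1) (hab : T.Adj a b) (hbi : 1 < T.degree b) (S S' : Pair V) :
    max4PC T S S' = (feature T a b par S ⬝ᵥ
      (Matrix.fromBlocks 0 (Matrix.diagonal (planeCoeff T b))
        (Matrix.diagonal (planeCoeff T b)) 0).mulVec (feature T a b par S') : ℤ) := by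
  have hb : ∀ x, T.Adj a x → x = b := fun x hx => eq_of_degree_eq_one ha hx hab
  have hR : feature T a b par S ⬝ᵥ
      (Matrix.fromBlocks 0 (Matrix.diagonal (planeCoeff T b))
        (Matrix.diagonal (planeCoeff T b)) 0).mulVec (feature T a b par S') =
      totalDepth T a S + totalDepth T a S' - 2 * ∑ v : Inner T,
        (touches par S v * covers par S' v + covers par S v * touches par S' v) := by
    have h1 : feature T a b par S ⬝ᵥ
      (Matrix.fromBlocks 0 (Matrix.diagonal (planeCoeff T b))
        (Matrix.diagonal (planeCoeff T b)) 0).mulVec (feature T a b par S') =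
        ∑ v : Inner T, (planeCoeff T b v * (feature T a b par S (.inl v) *
          feature T a b par S' (.inr v) +
          feature T a b par S (.inr v) * feature T a b par S' (.inl v))) := by
      rw [Matrix.fromBlocks_mulVec]
      simp only [dotProduct, Fintype.sum_sum_type, Sum.elim_inl, Sum.elim_inr,
        Matrix.zero_mulVec, zero_add, add_zero, Matrix.mulVec_diagonal, Function.comp]
      rw [← Finset.sum_add_distrib]
      exact Finset.sum_congr rfl fun v _ => by ring
    -- At `b` both touching coordinates are `1`, so this plane, with coefficient `1`, yields the two
    -- total depths besides its own covering terms.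
    have h2 : ∀ v : Inner T, planeCoeff T b v * (feature T a b par S (.inl v) *
          feature T a b par S' (.inr v) +
          feature T a b par S (.inr v) * feature T a b par S' (.inl v)) =
        (if v = ⟨b, hbi⟩ then totalDepth T a S + totalDepth T a S' else 0) -
        2 * (touches par S v * covers par S' v + covers par S v * touches par S' v) := by
      intro v
      by_cases hv : v.1 = b
      · have hv' : v = ⟨b, hbi⟩ := Subtype.ext hv
        subst hv'
        simp [planeCoeff, feature, h.touches_child hb]
        ring
      · have hv' : v ≠ ⟨b, hbi⟩ := fun hh => hv (congrArg Subtype.val hh)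
        simp [planeCoeff, feature, hv, hv']
    rw [h1, Finset.sum_congr rfl fun v _ => h2 v, Finset.sum_sub_distrib, ← Finset.mul_sum]
    simp
  rw [hR]
  obtain ⟨⟨w, x⟩, hwx⟩ := S
  obtain ⟨⟨y, z⟩, hyz⟩ := S'
  have hne : w ≠ x := by simpa using hwx
  have hne' : y ≠ z := by simpa using hyz
  change (((max (max (T.dist w x + T.dist y z) (T.dist w y + T.dist x z))
        (T.dist w z + T.dist x y) : ℕ) : ℝ)) = _
  have hmain := h.max_dist_add_dist hT w x y z
  rw [← Int.cast_natCast (R := ℝ), Int.cast_inj, hmain]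
  change _ = (T.dist a w : ℤ) + T.dist a x + (T.dist a y + T.dist a z) - 2 * ∑ v : Inner T,
        (touches par ⟨s(w, x), hwx⟩ v * covers par ⟨s(y, z), hyz⟩ v +
          covers par ⟨s(w, x), hwx⟩ v * touches par ⟨s(y, z), hyz⟩ v)
  congr 2
  symm
  have hsub : ∀ g : V → ℤ, (∀ v, ¬ 1 < T.degree v → g v = 0) →
      ∑ v : Inner T, g v = ∑ v, g v := by
    intro g hg
    rw [← Finset.sum_subtype (Finset.univ.filter fun v => 1 < T.degree v) (by simp) g]
    refine Finset.sum_subset (Finset.subset_univ _) fun v _ hv => hg v ?_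
    simpa using hv
  rw [← hsub]
  · refine Finset.sum_congr rfl fun v _ => ?_
    have hva : v.1 ≠ a := by
      intro hva
      have := v.2
      rw [hva] at this
      omega
    rw [touches_mk_eq_below hva, covers_mk_eq_below hva, touches_mk_eq_below hva,
      covers_mk_eq_below hva]
  · intro v hv
    by_cases hva : v = a
    · simp [below, hva]
    · rw [not_inner_iff hT] at hv
      -- A leaf other than the root has only itself below it, so it cannot cover two distinct
      -- vertices.
      have hz : ∀ {x y : V}, x ≠ y → below a par x v * below a par y v = 0 := by
        intro x y hxy
        unfold below
        by_cases h1 : Anc par v x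
        · by_cases h2 : Anc par v y
          · exact absurd ((h.eq_of_anc_of_degree_eq_one hva hv h1).symm.trans
              (h.eq_of_anc_of_degree_eq_one hva hv h2)) hxy
          · simp [h2]
        · simp [h1]
      rw [hz hne, hz hne']
      simp

end IsParent

/-! ### Size, basis and determinant from generation of the lattice -/

section Conclusions

variable [Fintype V] {T : SimpleGraph V} [DecidableRel T.Adj]

lemma card_inner (hT : T.IsTree) [Nontrivial V] :
    (Fintype.card (Inner T) : ℤ) = Fintype.card V - numLeaves T := by
  have h1 : Fintype.card (Inner T) = (Finset.univ.filter fun v => 1 < T.degree v).card :=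
    Fintype.card_subtype _
  have h2 := Finset.card_filter_add_card_filter_not (s := (Finset.univ : Finset V))
    (fun v => 1 < T.degree v)
  rw [Finset.filter_congr fun v _ => IsParent.not_inner_iff hT.1 v] at h2
  rw [Finset.card_univ] at h2
  unfold numLeaves
  omega

variable [DecidableEq V]

lemma det_plane (b : Inner T) :
    (Matrix.fromBlocks 0 (Matrix.diagonal (planeCoeff T b))
        (Matrix.diagonal (planeCoeff T b)) 0).det =
      (-1) ^ Fintype.card (Inner T) * 2 ^ (2 * (Fintype.card (Inner T) - 1)) := by
  rw [det_fromBlocks_zero_diagonal]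
  congr 1
  have : ∏ v : Inner T, planeCoeff T b v = (-2) ^ (Fintype.card (Inner T) - 1) := by
    rw [← Finset.mul_prod_erase _ _ (Finset.mem_univ b)]
    rw [Finset.prod_congr rfl (g := fun _ => (-2 : ℤ))]
    · simp [planeCoeff, Finset.card_erase_of_mem]
    · intro v hv
      have : v ≠ b := Finset.ne_of_mem_erase hv
      simp [planeCoeff, Subtype.coe_inj, this]
  rw [this, ← pow_mul, mul_comm, pow_mul, pow_mul]
  norm_num

/-- If the coordinates of the pairs `r k` generate the lattice of all integer vectors, then these
pairs index a basis of the rows of `max4PC T`, of known size and determinant. -/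
theorem conclusions_of_span_eq_top {a b : V} {par : V → V} (h : IsParent T a par)
    (hT : T.IsTree) [Nontrivial V] (ha : T.degree a = 1) (hab : T.Adj a b)
    (hbi : 1 < T.degree b) (r : Inner T ⊕ Inner T → Pair V)
    (hr : Submodule.span ℤ (Set.range fun k => feature T a b par (r k)) = ⊤)
    (B : Finset (Pair V)) (hB : (B : Set (Pair V)) = Set.range r) :
    (B.card : ℤ) = 2 * ((Fintype.card V : ℤ) - (numLeaves T : ℤ)) ∧
    (LinearIndependent ℝ (fun b : B => (max4PC T).row b.1) ∧
      Submodule.span ℝ (Set.range fun b : B => (max4PC T).row b.1) =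
        Submodule.span ℝ (Set.range (max4PC T).row)) ∧
    ((max4PC T).submatrix (fun b : B => b.1) (fun b : B => b.1)).det =
      (-1) ^ ((Fintype.card V : ℤ) - (numLeaves T : ℤ)) *
        2 ^ (2 * ((Fintype.card V : ℤ) - (numLeaves T : ℤ) - 1)) := by
  have hM := h.max4PC_eq_feature hT.1 ha hab hbi
  have hdet := det_plane (T := T) ⟨b, hbi⟩
  have hpos : 0 < Fintype.card (Inner T) := Fintype.card_pos_iff.2 ⟨⟨b, hbi⟩⟩
  have hinj := injective_of_span_eq_top hr
  let e : Inner T ⊕ Inner T ≃ B := Equiv.ofBijective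
    (fun k => ⟨r k, by rw [← Finset.mem_coe, hB]; exact ⟨k, rfl⟩⟩)
    ⟨fun k l hkl => hinj (congrArg Subtype.val hkl), fun ⟨S, hS⟩ => by
      rw [← Finset.mem_coe, hB] at hS
      obtain ⟨k, hk⟩ := hS
      exact ⟨k, Subtype.ext hk⟩⟩
  rw [← card_inner hT]
  refine ⟨?_, ⟨?_, ?_⟩, ?_⟩
  · have := Fintype.card_congr e
    rw [Fintype.card_sum, Fintype.card_coe] at this
    rw [← this]
    push_cast
    ring
  · rw [← linearIndependent_equiv e]
    refine linearIndependent_row_of_span_eq_top hM ?_ hr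
    rw [hdet]
    positivity
  · rw [← span_row_of_span_eq_top hM hr, ← e.surjective.range_comp]
    rfl
  · rw [← Matrix.det_submatrix_equiv_self e, Matrix.submatrix_submatrix]
    have := det_submatrix_of_span_eq_top hM hr
    rw [hdet] at this
    refine Eq.trans this ?_
    -- There is at least one inner vertex, so the truncated exponent `m - 1` agrees with the integer
    -- exponent of the conclusion.
    obtain ⟨m, hm⟩ := Nat.exists_eq_succ_of_ne_zero hpos.ne'
    rw [hm]
    push_cast
    rw [show (2 : ℤ) * ((m : ℤ) + 1 - 1) = ((2 * m : ℕ) : ℤ) by push_cast; ring,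
      zpow_natCast, show (m : ℤ) + 1 = ((m + 1 : ℕ) : ℤ) by push_cast; ring, zpow_natCast]

end Conclusions

end

/-! ### Cut vertices and blocks in the line graph of a tree -/

section

open SimpleGraph Finset

variable {V : Type*} {T : SimpleGraph V}

/-- The union, over the vertices `v` in `R`, of the cliques formed by the edges at `v`. -/
def cliqueSub (T : SimpleGraph V) (R : Set V) : T.lineGraph.Subgraph where
  verts := {e | ∃ v ∈ R, v ∈ e.1}
  Adj e f := e ≠ f ∧ ∃ v ∈ R, v ∈ e.1 ∧ v ∈ f.1
  adj_sub := by
    rintro e f ⟨hne, v, -, he, hf⟩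
    exact lineGraph_adj_iff_exists.2 ⟨hne, v, he, hf⟩
  edge_vert := by
    rintro e f ⟨-, v, hv, he, -⟩
    exact ⟨v, hv, he⟩
  symm := ⟨by
    rintro e f ⟨hne, v, hv, he, hf⟩
    exact ⟨hne.symm, v, hv, hf, he⟩⟩

lemma edge_eq_of_mem {e : T.edgeSet} {v w : V} (hv : v ∈ e.1) (hw : w ∈ e.1) (hne : v ≠ w) :
    e.1 = s(v, w) :=
  (Sym2.mem_and_mem_iff hne).1 ⟨hv, hw⟩

lemma exists_edge_eq {e : T.edgeSet} {v : V} (hv : v ∈ e.1) : ∃ w, T.Adj v w ∧ e.1 = s(v, w) := by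
  obtain ⟨w, hw⟩ := hv
  have := e.2
  rw [hw] at this
  exact ⟨w, this, hw⟩

lemma edge_ext_of_mem {e f : T.edgeSet} {v w : V} (hne : v ≠ w) (hv : v ∈ e.1) (hw : w ∈ e.1)
    (hv' : v ∈ f.1) (hw' : w ∈ f.1) : e = f :=
  Subtype.ext ((edge_eq_of_mem hv hw hne).trans (edge_eq_of_mem hv' hw' hne).symm)

/-- Deleting an edge `e` of an acyclic graph from (a subgraph of) its line graph separates the
edges at one end of `e` from the edges at the other end. -/
lemma not_reachable_deleteVerts (hT : T.IsAcyclic) (H : T.lineGraph.Subgraph)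
    {e f g : T.edgeSet} {v w : V} (he : e.1 = s(v, w)) (hfe : f ≠ e) (hv : v ∈ f.1)
    (hw : w ∈ g.1) : ¬ (H.deleteVerts {e}).spanningCoe.Reachable f g := by
  intro hreach
  have hbridge := isAcyclic_iff_forall_isBridge.1 hT e.2
  rw [he, isBridge_iff] at hbridge
  have hedge : ∀ k : T.edgeSet, k ≠ e → ∀ x ∈ k.1, ∀ y ∈ k.1,
      (T.deleteEdges {s(v, w)}).Reachable x y := by
    intro k hk x hx y hy
    by_cases hxy : x = y
    · rw [hxy]
    · have h1 := edge_eq_of_mem hx hy hxy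
      have h2 : T.Adj x y := by
        have := k.2
        rwa [h1] at this
      refine Adj.reachable ?_
      rw [deleteEdges_adj]
      refine ⟨h2, fun h3 => hk (Subtype.ext ?_)⟩
      rw [h1, he]
      exact h3
  rw [reachable_iff_reflTransGen] at hreach
  -- A chain of edges avoiding `e` gives a connection in `T` without `e`. Reaching `w` from `v` in
  -- this way would contradict that `e` is a bridge.
  have hinv : ∀ x ∈ g.1, (T.deleteEdges {s(v, w)}).Reachable v x := by
    clear hw
    induction hreach with
    | refl => exact fun x hx => hedge f hfe v hv x hx
    | tail _ hadj ih =>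
      rename_i k l _
      intro x hx
      have hadj' := Subgraph.deleteVerts_adj.1 hadj
      obtain ⟨-, y, hyk, hyl⟩ := lineGraph_adj_iff_exists.1 (H.adj_sub hadj'.2.2.2.2)
      exact (ih y hyk).trans (hedge l hadj'.2.2.2.1 y hyl x hx)
  exact hbridge (hinv w hw)

lemma isCutVertex_cliqueSub_iff [Fintype V] [DecidableRel T.Adj] (hT : T.IsAcyclic) {R : Set V}
    (hR : ∀ v ∈ R, 1 < T.degree v) (e : T.edgeSet) :
    IsCutVertex (cliqueSub T R) e ↔ ∀ v ∈ e.1, v ∈ R := by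
  constructor
  · rintro ⟨⟨v, hvR, hve⟩, x, y, hx, hy, hreach, hnot⟩ w hw
    by_contra hwR
    have hvw : v ≠ w := fun h => hwR (h ▸ hvR)
    have honly : ∀ u ∈ R, u ∈ e.1 → u = v := by
      intro u huR hue
      rw [edge_eq_of_mem hve hw hvw, Sym2.mem_iff] at hue
      rcases hue with h | h
      · exact h
      · exact absurd (h ▸ huR) hwR
    set H := (cliqueSub T R).deleteVerts {e} with hH
    have hadjH : ∀ f g : T.edgeSet, f ≠ e → g ≠ e → (cliqueSub T R).Adj f g →
        H.spanningCoe.Adj f g := fun f g hf hg h =>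
      Subgraph.deleteVerts_adj.2 ⟨(cliqueSub T R).edge_vert h, hf,
        (cliqueSub T R).edge_vert h.symm, hg, h⟩
    rw [reachable_iff_reflTransGen] at hreach
    -- All neighbours of `e` contain its only end `v` in `R`, hence are equal or adjacent to each
    -- other, and a walk through `e` can be shortcut. The second clause carries the induction across
    -- `e`.
    have hinv : (y ≠ e → H.spanningCoe.Reachable x y) ∧
        (y = e → ∀ z, (cliqueSub T R).Adj e z → H.spanningCoe.Reachable x z) := by
      clear hnot hy
      induction hreach with
      | refl => exact ⟨fun _ => Reachable.refl _, fun h => absurd h hx⟩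
      | tail _ hadj ih =>
        rename_i k l _
        have hadj : (cliqueSub T R).Adj k l := hadj
        by_cases hk : k = e
        · subst hk
          exact ⟨fun _ => ih.2 rfl l hadj, fun h => absurd h hadj.1.symm⟩
        · refine ⟨fun hl => (ih.1 hk).trans (hadjH k l hk hl hadj).reachable, ?_⟩
          rintro rfl z hz
          by_cases hkz : k = z
          · exact hkz ▸ ih.1 hk
          · obtain ⟨-, u, huR, huk, hul⟩ := hadj
            obtain ⟨hzne, u', huR', hul', huz⟩ := hz
            have h1 := honly u huR hul
            have h2 := honly u' huR' hul'
            subst h1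
            subst h2
            exact (ih.1 hk).trans
              (hadjH k z hk hzne.symm ⟨hkz, u', huR', huk, huz⟩).reachable
    exact hnot (hinv.1 hy)
  · intro he
    obtain ⟨⟨v, w⟩, hvw⟩ := e
    change T.Adj v w at hvw
    have hv : v ∈ R := he v (Sym2.mem_mk_left v w)
    have hw : w ∈ R := he w (Sym2.mem_mk_right v w)
    have hex : ∀ {v} w, 1 < T.degree v → ∃ x, T.Adj v x ∧ x ≠ w := by
      intro v w hv
      obtain ⟨x, hx, hxw⟩ := Finset.exists_mem_ne hv w
      exact ⟨x, (T.mem_neighborFinset v x).1 hx, hxw⟩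
    obtain ⟨x, hx, hxw⟩ := hex w (hR v hv)
    obtain ⟨y, hy, hyv⟩ := hex v (hR w hw)
    have hne : (⟨s(v, x), hx⟩ : T.edgeSet) ≠ ⟨s(v, w), hvw⟩ := by
      intro h
      exact hxw (Sym2.congr_right.1 (congrArg Subtype.val h))
    have hne' : (⟨s(w, y), hy⟩ : T.edgeSet) ≠ ⟨s(v, w), hvw⟩ := by
      intro h
      have h' : s(w, y) = s(v, w) := congrArg Subtype.val h
      rw [Sym2.eq_swap (a := v)] at h'
      exact hyv (Sym2.congr_right.1 h')
    refine ⟨⟨v, hv, Sym2.mem_mk_left _ _⟩, ⟨s(v, x), hx⟩, ⟨s(w, y), hy⟩, hne, hne', ?_, ?_⟩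
    · refine Reachable.trans (v := ⟨s(v, w), hvw⟩) (Adj.reachable ?_) (Adj.reachable ?_)
      · exact ⟨hne, v, hv, Sym2.mem_mk_left _ _, Sym2.mem_mk_left _ _⟩
      · exact ⟨hne'.symm, w, hw, Sym2.mem_mk_right _ _, Sym2.mem_mk_left _ _⟩
    · exact not_reachable_deleteVerts hT _ rfl hne (Sym2.mem_mk_left _ _) (Sym2.mem_mk_left _ _)

lemma cliqueSub_singleton_connected {v w : V} (hvw : T.Adj v w) :
    (cliqueSub T {v}).Connected := by
  rw [Subgraph.connected_iff]
  refine ⟨?_, ⟨⟨s(v, w), hvw⟩, v, rfl, Sym2.mem_mk_left _ _⟩⟩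
  rw [Subgraph.preconnected_iff]
  rintro ⟨e, u, hu, he⟩ ⟨f, u', hu', hf⟩
  rw [Set.mem_singleton_iff] at hu hu'
  subst hu hu'
  by_cases hef : e = f
  · subst hef
    exact Reachable.refl _
  · exact Adj.reachable ⟨hef, _, rfl, he, hf⟩

/-- A walk in `C` from `s` that leaves the clique at `v` does so through an edge `g` at `v`. Since
the end `x` of `s` is not in `R`, this `g` is not `s`, so deleting `g` separates `s` from the next
edge and `g` would be a cut vertex of `C`. Thus `C` lies in the clique, which itself has no cut
vertex, and maximality gives equality. -/
lemma block_eq [Fintype V] [DecidableRel T.Adj] (hT : T.IsAcyclic) {R : Set V}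
    (hR : ∀ v ∈ R, 1 < T.degree v) {C : T.lineGraph.Subgraph} (hC : IsBlock (cliqueSub T R) C)
    {s : T.edgeSet} (hs : s ∈ C.verts) {x v : V} (hsv : s.1 = s(x, v)) (hv : v ∈ R)
    (hx : x ∉ R) : C = cliqueSub T {v} := by
  obtain ⟨⟨hle, hconn, hcut⟩, hmax⟩ := hC
  have hvs : v ∈ s.1 := hsv ▸ Sym2.mem_mk_right _ _
  have hreach : ∀ f, C.spanningCoe.Reachable s f → v ∈ f.1 := by
    intro f hf
    rw [reachable_iff_reflTransGen] at hf
    induction hf with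
    | refl => exact hvs
    | tail hg hadj ih =>
      rename_i g g'
      have hadj : C.Adj g g' := hadj
      by_contra hvg
      obtain ⟨hne, y, hyR, hyg, hyg'⟩ := hle.2 hadj
      have hyv : v ≠ y := fun h => hvg (h ▸ hyg')
      have hgeq := edge_eq_of_mem ih hyg hyv
      have hsg : s ≠ g := by
        rintro rfl
        have hyx : y ∈ s.1 := hyg
        rw [hsv, Sym2.mem_iff] at hyx
        rcases hyx with h | h
        · exact hx (h ▸ hyR)
        · exact hyv h.symm
      refine hcut g ⟨C.edge_vert hadj, s, g', hsg, hne.symm, ?_, ?_⟩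
      · rw [reachable_iff_reflTransGen]
        exact hg.tail hadj
      · exact not_reachable_deleteVerts hT C hgeq hsg hvs hyg'
  have hmem : ∀ f ∈ C.verts, v ∈ f.1 := by
    intro f hf
    refine hreach f ?_
    have h1 := (Subgraph.preconnected_iff.1 hconn.preconnected) ⟨s, hs⟩ ⟨f, hf⟩
    exact h1.map C.coeEmbeddingSpanningCoe.toHom
  have hleC : C ≤ cliqueSub T {v} := by
    refine ⟨fun f hf => ⟨v, rfl, hmem f hf⟩, fun f g hfg => ⟨(C.adj_sub hfg).ne, v, rfl,
      hmem f (C.edge_vert hfg), hmem g (C.edge_vert hfg.symm)⟩⟩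
  refine le_antisymm hleC (hmax ⟨?_, ?_, ?_⟩ hleC)
  · refine ⟨?_, ?_⟩
    · rintro f ⟨u, rfl, hu⟩
      exact ⟨u, hv, hu⟩
    · rintro f g ⟨hne, u, rfl, hu⟩
      exact ⟨hne, u, hv, hu⟩
  · obtain ⟨w, hw, -⟩ := exists_edge_eq hvs
    exact cliqueSub_singleton_connected hw
  · intro e he
    rw [isCutVertex_cliqueSub_iff hT (by rintro u rfl; exact hR u hv)] at he
    obtain ⟨⟨p, q⟩, hpq⟩ := e
    change T.Adj p q at hpq
    have h1 : p = v := he p (Sym2.mem_mk_left _ _)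
    have h2 : q = v := he q (Sym2.mem_mk_right _ _)
    exact hpq.ne (h1.trans h2.symm)

/-- The cut vertices in the clique at `v` are the edges from `v` to `R`, which still belong to the
clique at their other end. Two distinct edges meet in at most one vertex, so no adjacency of another
clique is lost. -/
lemma cliqueSub_delete_edges [Fintype V] [DecidableRel T.Adj] (hT : T.IsAcyclic) {R : Set V}
    (hR : ∀ v ∈ R, 1 < T.degree v) {v : V} (hv : v ∈ R) :
    ((cliqueSub T R).deleteEdges (cliqueSub T {v}).edgeSet).deleteVerts
      {x | x ∈ (cliqueSub T {v}).verts ∧ ¬ IsCutVertex (cliqueSub T R) x} =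
    cliqueSub T (R \ {v}) := by
  have hmem : ∀ e : T.edgeSet, e ∈ (cliqueSub T {v}).verts ↔ v ∈ e.1 := fun e =>
    ⟨by rintro ⟨u, rfl, h⟩; exact h, fun h => ⟨v, rfl, h⟩⟩
  have hverts : ∀ e : T.edgeSet, e ∈ (cliqueSub T R).verts ∧
      ¬ (v ∈ e.1 ∧ ¬ ∀ u ∈ e.1, u ∈ R) ↔ e ∈ (cliqueSub T (R \ {v})).verts := by
    intro e
    constructor
    · rintro ⟨⟨u, huR, hue⟩, hnot⟩
      by_cases hve : v ∈ e.1
      · have hall : ∀ u ∈ e.1, u ∈ R := by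
          by_contra hh
          exact hnot ⟨hve, hh⟩
        obtain ⟨w, hw, hew⟩ := exists_edge_eq hve
        have hwe : w ∈ e.1 := hew ▸ Sym2.mem_mk_right _ _
        exact ⟨w, ⟨hall w hwe, hw.ne'⟩, hwe⟩
      · exact ⟨u, ⟨huR, fun h => hve (h ▸ hue)⟩, hue⟩
    · rintro ⟨u, ⟨huR, huv⟩, hue⟩
      refine ⟨⟨u, huR, hue⟩, fun ⟨hve, hnot⟩ => hnot fun w hw => ?_⟩
      rw [edge_eq_of_mem hue hve huv, Sym2.mem_iff] at hw
      rcases hw with rfl | rfl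
      · exact huR
      · exact hv
  have hset : {x | x ∈ (cliqueSub T {v}).verts ∧ ¬ IsCutVertex (cliqueSub T R) x} =
      {e | v ∈ e.1 ∧ ¬ ∀ u ∈ e.1, u ∈ R} := by
    ext e
    rw [Set.mem_ofPred_eq, Set.mem_ofPred_eq, hmem, isCutVertex_cliqueSub_iff hT hR]
  rw [hset]
  refine Subgraph.ext ?_ ?_
  · ext e
    exact hverts e
  · ext e f
    rw [Subgraph.deleteVerts_adj, Subgraph.deleteEdges_adj, Subgraph.mem_edgeSet]
    constructor
    · rintro ⟨-, -, -, -, ⟨hne, u, huR, hue, huf⟩, hnot⟩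
      refine ⟨hne, u, ⟨huR, ?_⟩, hue, huf⟩
      rintro rfl
      exact hnot ⟨hne, u, rfl, hue, huf⟩
    · rintro ⟨hne, u, ⟨huR, huv⟩, hue, huf⟩
      have he := (hverts e).2 ⟨u, ⟨huR, huv⟩, hue⟩
      have hf := (hverts f).2 ⟨u, ⟨huR, huv⟩, huf⟩
      refine ⟨he.1, he.2, hf.1, hf.2, ⟨hne, u, huR, hue, huf⟩, ?_⟩
      rintro ⟨-, v', rfl, hve, hvf⟩
      exact hne (edge_ext_of_mem huv hue hve huf hvf)

/-- Without cut vertices at `v`, no edge at `v` belongs to another clique of the union. -/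
lemma cliqueSub_delete_verts {R : Set V} {v : V} (hv : v ∈ R)
    (hcut : ∀ e : T.edgeSet, v ∈ e.1 → ¬ ∀ u ∈ e.1, u ∈ R) :
    (cliqueSub T R).deleteVerts (cliqueSub T {v}).verts = cliqueSub T (R \ {v}) := by
  have hmem : ∀ e : T.edgeSet, e ∈ (cliqueSub T {v}).verts ↔ v ∈ e.1 := fun e =>
    ⟨by rintro ⟨u, rfl, h⟩; exact h, fun h => ⟨v, rfl, h⟩⟩
  have hnot : ∀ (e : T.edgeSet) (u), u ∈ R → u ≠ v → u ∈ e.1 → v ∉ e.1 := by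
    intro e u huR huv hue hve
    refine hcut e hve fun w hw => ?_
    rw [edge_eq_of_mem hue hve huv, Sym2.mem_iff] at hw
    rcases hw with rfl | rfl
    · exact huR
    · exact hv
  refine Subgraph.ext ?_ ?_
  · ext e
    rw [Subgraph.deleteVerts_verts, Set.mem_sdiff, hmem]
    constructor
    · rintro ⟨⟨u, huR, hue⟩, hve⟩
      exact ⟨u, ⟨huR, fun h => hve (h ▸ hue)⟩, hue⟩
    · rintro ⟨u, ⟨huR, huv⟩, hue⟩
      exact ⟨⟨u, huR, hue⟩, hnot e u huR huv hue⟩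
  · ext e f
    rw [Subgraph.deleteVerts_adj, hmem, hmem]
    constructor
    · rintro ⟨-, hve, -, -, hne, u, huR, hue, huf⟩
      exact ⟨hne, u, ⟨huR, fun h => hve (h ▸ hue)⟩, hue, huf⟩
    · rintro ⟨hne, u, ⟨huR, huv⟩, hue, huf⟩
      exact ⟨⟨u, huR, hue⟩, hnot e u huR huv hue, ⟨u, huR, huf⟩, hnot f u huR huv huf,
        hne, u, huR, hue, huf⟩

end

/-! ### The invariant of the algorithm and the shape of its outputs -/

section

open SimpleGraph Finset

variable {V : Type*} {T : SimpleGraph V}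

/-- `S` is an admissible second pair for the inner vertex `v`: it consists of the parent of `v`
and an inner child of `v` or, if there is no such child, of `v` and a child of `v`. -/
def IsSecond [Fintype V] (T : SimpleGraph V) [DecidableRel T.Adj] (par : V → V) (v : V)
    (S : Pair V) : Prop :=
  (∃ w, 1 < T.degree w ∧ par w = v ∧ S.1 = s(par v, w)) ∨
  ((∀ w, 1 < T.degree w → par w ≠ v) ∧ ∃ l, par l = v ∧ S.1 = s(v, l))

lemma eq_mk_of_coe_eq_symmDiff {e : Sym2 V} {x v w : V} (hxv : x ≠ v) (hxw : x ≠ w) (hwv : w ≠ v)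
    (he : (e : Set V) = symmDiff (s(x, v) : Set V) (s(v, w) : Set V)) : e = s(x, w) := by
  refine SetLike.ext fun y => ?_
  have h1 : y ∈ (e : Set V) ↔ y ∈ symmDiff (s(x, v) : Set V) (s(v, w) : Set V) := by rw [he]
  rw [Set.mem_symmDiff, SetLike.mem_coe, SetLike.mem_coe, SetLike.mem_coe] at h1
  rw [h1]
  simp only [Sym2.mem_iff]
  constructor
  · rintro (⟨h2 | h2, h3⟩ | ⟨h2 | h2, h3⟩)
    · exact Or.inl h2
    · exact absurd (Or.inl h2) h3
    · exact absurd (Or.inr h2) h3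
    · exact Or.inr h2
  · rintro (rfl | rfl)
    · exact Or.inl ⟨Or.inl rfl, by simp [hxv, hxw]⟩
    · exact Or.inr ⟨Or.inr rfl, by simp [hwv, hxw.symm]⟩

lemma mem_cliqueSub_singleton {v : V} {e : T.edgeSet} :
    e ∈ (cliqueSub T {v}).verts ↔ v ∈ e.1 :=
  ⟨by rintro ⟨u, rfl, h⟩; exact h, fun h => ⟨v, rfl, h⟩⟩

/-- Adding a processed vertex `v` to the description of an output. -/
lemma exists_second_insert [Fintype V] [DecidableRel T.Adj] {par : V → V} {R : Set V} {v : V}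
    (hv : v ∈ R) {s : T.edgeSet} (hsv : s.1 = s(par v, v)) {d : Pair V} (hd : IsSecond T par v d)
    {B O : Set (Pair V)} (h : ∃ t : V → Pair V, (∀ u ∈ R \ {v}, IsSecond T par u (t u)) ∧
      ∀ S, S ∈ O ↔ S ∈ B ∪ {edgePair s, d} ∨ ∃ u ∈ R \ {v}, S.1 = s(par u, u) ∨ S = t u) :
    ∃ t : V → Pair V, (∀ u ∈ R, IsSecond T par u (t u)) ∧
      ∀ S, S ∈ O ↔ S ∈ B ∨ ∃ u ∈ R, S.1 = s(par u, u) ∨ S = t u := by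
  classical
  obtain ⟨t, ht, hOt⟩ := h
  refine ⟨Function.update t v d, fun u hu => ?_, fun S => ?_⟩
  · by_cases huv : u = v
    · subst huv
      rwa [Function.update_self]
    · rw [Function.update_of_ne huv]
      exact ht u ⟨hu, huv⟩
  · rw [hOt]
    have hedge : S = edgePair s ↔ S.1 = s(par v, v) := by
      rw [← hsv, Subtype.ext_iff]; rfl
    constructor
    · rintro ((hS | hS | hS) | ⟨u, hu, hS⟩)
      · exact Or.inl hS
      · exact Or.inr ⟨v, hv, Or.inl (hedge.1 hS)⟩
      · exact Or.inr ⟨v, hv, Or.inr (by rw [Function.update_self]; exact hS)⟩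
      · exact Or.inr ⟨u, hu.1, by rwa [Function.update_of_ne hu.2]⟩
    · rintro (hS | ⟨u, hu, hS⟩)
      · exact Or.inl (Or.inl hS)
      · by_cases huv : u = v
        · subst huv
          rw [Function.update_self] at hS
          exact Or.inl (Or.inr (hS.imp hedge.2 id))
        · rw [Function.update_of_ne huv] at hS
          exact Or.inr ⟨u, ⟨hu, huv⟩, hS⟩

namespace IsParent

variable {a b : V} {par : V → V}

lemma eq_of_parent_edge_eq (h : IsParent T a par) {v w : V} (hv : v ≠ a) (hw : w ≠ a)
    (he : s(par v, v) = s(par w, w)) : v = w := by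
  rw [Sym2.eq_iff] at he
  rcases he with ⟨-, h1⟩ | ⟨h1, h2⟩
  · exact h1
  · have e1 := h.dist v hv
    have e2 := h.dist w hw
    rw [h1] at e1
    rw [← h2] at e2
    omega

lemma par_child (h : IsParent T a par) (hab : T.Adj a b) : par b = a := by
  rcases h.eq_of_adj a b hab with ⟨-, h1⟩ | ⟨h1, -⟩
  · exact h1.symm
  · exact absurd rfl h1

lemma par_eq_of_adj (h : IsParent T a par) {v w : V} (hvw : T.Adj v w) (hne : w ≠ par v) :
    par w = v := by
  rcases h.eq_of_adj v w hvw with ⟨-, h1⟩ | ⟨-, h1⟩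
  · exact h1.symm
  · exact absurd h1 hne

lemma exists_child_of_subset (h : IsParent T a par) {R : Set V} {v : V} (hpv : par v ∉ R)
    {e : T.edgeSet} (hve : v ∈ e.1) (hall : ∀ u ∈ e.1, u ∈ R) :
    ∃ w ∈ R, par w = v ∧ e.1 = s(v, w) := by
  obtain ⟨w, hw, hew⟩ := exists_edge_eq hve
  have hwR : w ∈ R := hall w (hew ▸ Sym2.mem_mk_right _ _)
  exact ⟨w, hwR, h.par_eq_of_adj hw fun hh => hpv (hh ▸ hwR), hew⟩

variable [Fintype V] [DecidableRel T.Adj]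

lemma inner_child (h : IsParent T a par) (hcard : 3 ≤ Fintype.card V) (hT : T.Connected)
    (ha : T.degree a = 1) (hab : T.Adj a b) : 1 < T.degree b := by
  classical
  have hb : ∀ x, T.Adj a x → x = b := fun x hx => eq_of_degree_eq_one ha hx hab
  have : Nontrivial V := Fintype.one_lt_card_iff_nontrivial.1 (by omega)
  by_contra hcon
  rw [not_inner_iff hT] at hcon
  have hsub : (Finset.univ : Finset V) ⊆ {a, b} := by
    intro x _
    by_cases hx : x = a
    · simp [hx]
    · have := h.eq_of_anc_of_degree_eq_one hab.ne' hcon (h.anc_child hb hx)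
      simp [this]
  have h1 := Finset.card_le_card hsub
  have h2 : ({a, b} : Finset V).card ≤ 2 := Finset.card_le_two
  rw [Finset.card_univ] at h1
  omega

/-- Every edge has an inner end, and the vertex shared by two distinct edges is inner. -/
lemma top_eq_cliqueSub (h : IsParent T a par) (hb : ∀ x, T.Adj a x → x = b)
    (hbi : 1 < T.degree b) : (⊤ : T.lineGraph.Subgraph) = cliqueSub T {v | 1 < T.degree v} := by
  refine Subgraph.ext ?_ ?_
  · ext e
    refine ⟨fun _ => ?_, fun _ => trivial⟩
    obtain ⟨⟨x, y⟩, hxy⟩ := e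
    have key : ∀ u, u ≠ a → ∃ w, 1 < T.degree w ∧ w ∈ s(par u, u) := by
      intro u hu
      by_cases hp : par u = a
      · have := hb u (hp ▸ h.adj u hu)
        exact ⟨u, this ▸ hbi, Sym2.mem_mk_right _ _⟩
      · exact ⟨par u, h.degree_par hu hp, Sym2.mem_mk_left _ _⟩
    rcases h.eq_of_adj x y hxy with ⟨hy, rfl⟩ | ⟨hx, rfl⟩
    · exact key y hy
    · obtain ⟨w, hw, hmem⟩ := key x hx
      rw [Sym2.eq_swap] at hmem
      exact ⟨w, hw, hmem⟩
  · ext e f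
    constructor
    · intro hadj
      obtain ⟨hne, v, hve, hvf⟩ := lineGraph_adj_iff_exists.1 hadj
      refine ⟨hne, v, ?_, hve, hvf⟩
      obtain ⟨x, hx, hex⟩ := exists_edge_eq hve
      obtain ⟨y, hy, hfy⟩ := exists_edge_eq hvf
      refine Finset.one_lt_card.2 ⟨x, by simpa using hx, y, by simpa using hy, ?_⟩
      rintro rfl
      exact hne (Subtype.ext (hex.trans hfy.symm))
    · intro hadj
      exact (cliqueSub T _).adj_sub hadj

/-- The state of the algorithm in terms of the set `R` of inner vertices whose cliques have not
been processed: the starting edge and the stored edges lead from outside `R` into `R`. -/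
structure State (T : SimpleGraph V) [DecidableRel T.Adj] (par : V → V) (R : Set V)
    (s : T.edgeSet) (N : Set T.edgeSet) : Prop where
  inner : ∀ v ∈ R, 1 < T.degree v
  closed : ∀ w, 1 < T.degree w → par w ∈ R → w ∈ R
  notMem : s ∉ N
  frontier : ∀ e, e ∈ N ∨ e = s ↔ ∃ w ∈ R, par w ∉ R ∧ e.1 = s(par w, w)

lemma State.ne_root {R : Set V} {s : T.edgeSet} {N : Set T.edgeSet} (hst : State T par R s N)
    (ha : T.degree a = 1) {v : V} (hv : v ∈ R) : v ≠ a := by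
  rintro rfl
  have := hst.inner v hv
  omega

/-- Removing `v` from `R` takes `s` out of the frontier and brings in the edges from `v` to its
children in `R`. These are the cut vertices in the block: `c` becomes the start and the others are
stored. -/
lemma State.descend (h : IsParent T a par) (hT : T.IsAcyclic) (ha : T.degree a = 1) {R : Set V}
    {s : T.edgeSet} {N : Set T.edgeSet} (hst : State T par R s N) {v : V} (hv : v ∈ R)
    (hpv : par v ∉ R) (hsv : s.1 = s(par v, v)) {c : T.edgeSet} (hc : v ∈ c.1)
    (hcut : ∀ u ∈ c.1, u ∈ R) :
    State T par (R \ {v}) c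
      (N ∪ {x | x ∈ (cliqueSub T {v}).verts ∧ IsCutVertex (cliqueSub T R) x ∧ x ≠ c}) where
  inner u hu := hst.inner u hu.1
  closed u hu hpu := ⟨hst.closed u hu hpu.1, by rintro rfl; exact hpv hpu.1⟩
  notMem := by
    rintro (hcN | hcc)
    · obtain ⟨u, hu, hpu, hcu⟩ := (hst.frontier c).1 (Or.inl hcN)
      exact hpu (hcut _ (hcu ▸ Sym2.mem_mk_left _ _))
    · exact hcc.2.2 rfl
  frontier := by
    intro e
    constructor
    · have hcuts : ∀ e : T.edgeSet, v ∈ e.1 → (∀ u ∈ e.1, u ∈ R) →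
          ∃ w ∈ R \ {v}, par w ∉ R \ {v} ∧ e.1 = s(par w, w) := by
        intro e hve hall
        obtain ⟨u, huR, hpu, heu⟩ := h.exists_child_of_subset hpv hve hall
        refine ⟨u, ⟨huR, fun huv => ?_⟩, ?_, ?_⟩
        · rw [Set.mem_singleton_iff.1 huv] at hpu
          exact hpv (hpu.symm ▸ hv)
        · rw [hpu]
          exact fun hh => hh.2 rfl
        · rw [hpu, heu]
      rintro ((heN | ⟨he1, he2, -⟩) | rfl)
      · obtain ⟨u, hu, hpu, heu⟩ := (hst.frontier e).1 (Or.inl heN)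
        refine ⟨u, ⟨hu, ?_⟩, fun hh => hpu hh.1, heu⟩
        rintro rfl
        exact hst.notMem (Subtype.ext (hsv.trans heu.symm) ▸ heN)
      · rw [isCutVertex_cliqueSub_iff hT hst.inner] at he2
        exact hcuts e (mem_cliqueSub_singleton.1 he1) he2
      · exact hcuts e hc hcut
    · rintro ⟨u, ⟨hu, huv⟩, hpu, heu⟩
      by_cases hpuR : par u ∈ R
      · have hpuv : par u = v := by
          by_contra hh
          exact hpu ⟨hpuR, hh⟩
        by_cases hec : e = c
        · exact Or.inr hec
        · refine Or.inl (Or.inr ⟨?_, ?_, hec⟩)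
          · rw [mem_cliqueSub_singleton, heu, hpuv]
            exact Sym2.mem_mk_left _ _
          · rw [isCutVertex_cliqueSub_iff hT hst.inner, heu]
            intro x hx
            rcases Sym2.mem_iff.1 hx with rfl | rfl
            · exact hpuR
            · exact hu
      · rcases (hst.frontier e).2 ⟨u, hu, hpuR, heu⟩ with heN | hes
        · exact Or.inl (Or.inl heN)
        · refine absurd (h.eq_of_parent_edge_eq (hst.ne_root ha hu) (hst.ne_root ha hv) ?_) huv
          rw [← heu, ← hsv, hes]

/-- As `v` has no child in `R`, removing it only takes `s` out of the frontier; the remaining edges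
are those already stored. -/
lemma State.backtrack (h : IsParent T a par) (ha : T.degree a = 1) {R : Set V}
    {s : T.edgeSet} {N : Set T.edgeSet} (hst : State T par R s N) {v : V} (hv : v ∈ R)
    (hpv : par v ∉ R) (hsv : s.1 = s(par v, v)) (hno : ∀ w ∈ R, par w ≠ v) {w : T.edgeSet}
    (hw : w ∈ N) : State T par (R \ {v}) w (N \ {w}) where
  inner u hu := hst.inner u hu.1
  closed u hu hpu := ⟨hst.closed u hu hpu.1, by rintro rfl; exact hpv hpu.1⟩
  notMem hh := hh.2 rfl
  frontier := by
    intro e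
    constructor
    · intro he
      have heN : e ∈ N := by
        rcases he with he | rfl
        · exact he.1
        · exact hw
      obtain ⟨u, hu, hpu, heu⟩ := (hst.frontier e).1 (Or.inl heN)
      refine ⟨u, ⟨hu, ?_⟩, fun hh => hpu hh.1, heu⟩
      rintro rfl
      exact hst.notMem (Subtype.ext (hsv.trans heu.symm) ▸ heN)
    · rintro ⟨u, ⟨hu, huv⟩, hpu, heu⟩
      have hpuR : par u ∉ R := fun hh => hpu ⟨hh, hno u hu⟩
      rcases (hst.frontier e).2 ⟨u, hu, hpuR, heu⟩ with heN | hes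
      · by_cases hew : e = w
        · exact Or.inr hew
        · exact Or.inl ⟨heN, hew⟩
      · refine absurd (h.eq_of_parent_edge_eq (hst.ne_root ha hu) (hst.ne_root ha hv) ?_) huv
        rw [← heu, ← hsv, hes]

lemma State.isSecond_of_no_cut (h : IsParent T a par) (ha : T.degree a = 1) {R : Set V}
    {s : T.edgeSet} {N : Set T.edgeSet} (hst : State T par R s N) {v : V} (hv : v ∈ R)
    (hsv : s.1 = s(par v, v)) (hcut : ∀ e : T.edgeSet, v ∈ e.1 → ¬ ∀ u ∈ e.1, u ∈ R)
    {c : T.edgeSet} (hvc : v ∈ c.1) (hcs : c ≠ s) :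
    (∀ w ∈ R, par w ≠ v) ∧ IsSecond T par v (edgePair c) := by
  have hno : ∀ w ∈ R, par w ≠ v := by
    rintro w hw rfl
    refine hcut ⟨s(par w, w), h.adj w (hst.ne_root ha hw)⟩ (Sym2.mem_mk_left _ _) fun u hu => ?_
    rcases Sym2.mem_iff.1 hu with rfl | rfl
    · exact hv
    · exact hw
  refine ⟨hno, Or.inr ⟨fun w hw hpw => hno w (hst.closed w hw (hpw ▸ hv)) hpw, ?_⟩⟩
  obtain ⟨l, hl, hcl⟩ := exists_edge_eq hvc
  refine ⟨l, h.par_eq_of_adj hl ?_, hcl⟩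
  rintro rfl
  exact hcs (Subtype.ext (by rw [hcl, hsv, Sym2.eq_swap]))

theorem output_of_state (h : IsParent T a par) (hT : T.IsAcyclic) (ha : T.degree a = 1)
    {G : T.lineGraph.Subgraph} {s : T.edgeSet} {N : Set T.edgeSet} {B O : Set (Pair V)}
    (halg : AlgoReturns T G s N B O) :
    ∀ R, G = cliqueSub T R → State T par R s N →
      ∃ t : V → Pair V, (∀ v ∈ R, IsSecond T par v (t v)) ∧
        ∀ S, S ∈ O ↔ S ∈ B ∨ ∃ v ∈ R, S.1 = s(par v, v) ∨ S = t v := by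
  induction halg with
  | @descend G s N B O C c d hC hs hc hcut hd hO ih =>
    rintro R rfl hst
    obtain ⟨v, hv, hpv, hsv⟩ := (hst.frontier s).1 (Or.inr rfl)
    obtain rfl := block_eq hT hst.inner hC hs hsv hv hpv
    rw [isCutVertex_cliqueSub_iff hT hst.inner] at hcut
    rw [mem_cliqueSub_singleton] at hc
    obtain ⟨w, hwR, hpw, hcw⟩ := h.exists_child_of_subset hpv hc hcut
    refine exists_second_insert hv hsv (Or.inl ⟨w, hst.inner w hwR, hpw, ?_⟩)
      (ih (R \ {v}) (cliqueSub_delete_edges hT hst.inner hv)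
        (State.descend h hT ha hst hv hpv hsv hc hcut))
    rw [hsv, hcw] at hd
    refine eq_mk_of_coe_eq_symmDiff (h.adj v (hst.ne_root ha hv)).ne
      (fun hh => hpv (hh ▸ hwR)) (fun hwv => ?_) hd
    rw [hwv] at hpw
    exact hpv (hpw.symm ▸ hv)
  | @backtrack G s N B O C c w hC hs hcut hc hcs hw hO ih =>
    rintro R rfl hst
    obtain ⟨v, hv, hpv, hsv⟩ := (hst.frontier s).1 (Or.inr rfl)
    obtain rfl := block_eq hT hst.inner hC hs hsv hv hpv
    have hcut' : ∀ e : T.edgeSet, v ∈ e.1 → ¬ ∀ u ∈ e.1, u ∈ R := fun e he => by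
      rw [← isCutVertex_cliqueSub_iff hT hst.inner]
      exact hcut e (mem_cliqueSub_singleton.2 he)
    obtain ⟨hno, hsec⟩ := State.isSecond_of_no_cut h ha hst hv hsv hcut'
      (mem_cliqueSub_singleton.1 hc) hcs
    exact exists_second_insert hv hsv hsec (ih (R \ {v}) (cliqueSub_delete_verts hv hcut')
      (State.backtrack h ha hst hv hpv hsv hno hw))
  | @halt G s B C c hC hs hcut hc hcs =>
    rintro R rfl hst
    obtain ⟨v, hv, hpv, hsv⟩ := (hst.frontier s).1 (Or.inr rfl)
    obtain rfl := block_eq hT hst.inner hC hs hsv hv hpv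
    have hcut' : ∀ e : T.edgeSet, v ∈ e.1 → ¬ ∀ u ∈ e.1, u ∈ R := fun e he => by
      rw [← isCutVertex_cliqueSub_iff hT hst.inner]
      exact hcut e (mem_cliqueSub_singleton.2 he)
    obtain ⟨hno, hsec⟩ := State.isSecond_of_no_cut h ha hst hv hsv hcut'
      (mem_cliqueSub_singleton.1 hc) hcs
    -- With nothing stored, `s` is the whole frontier, so `v` is the only topmost vertex of `R`; it
    -- has no child in `R`, so nothing else remains.
    have hall : ∀ u, u ∈ R → u = v := by
      refine h.induction (fun hh => absurd rfl (hst.ne_root ha hh)) fun u hua ihu hu => ?_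
      by_cases hpu : par u ∈ R
      · exact absurd (ihu hpu) (hno u hu)
      · rcases (hst.frontier ⟨s(par u, u), h.adj u hua⟩).2 ⟨u, hu, hpu, rfl⟩ with heN | hes
        · exact absurd heN (Set.notMem_empty _)
        · exact h.eq_of_parent_edge_eq hua (hst.ne_root ha hv)
            ((congrArg Subtype.val hes).trans hsv)
    refine exists_second_insert hv hsv hsec
      -- The value is arbitrary, since `R \ {v}` is empty.
      ⟨fun _ => edgePair c, fun u hu => absurd (hall u hu.1) hu.2, fun S => ?_⟩
    exact ⟨Or.inl, fun hS => hS.resolve_right fun ⟨u, hu, _⟩ => hu.2 (hall u hu.1)⟩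

/-- An output of the algorithm consists of the parent edges of the inner vertices and of one
admissible second pair for each of them. -/
theorem output_eq (h : IsParent T a par) (hT : T.IsTree) (ha : T.degree a = 1)
    (hab : T.Adj a b) (hbi : 1 < T.degree b) {s : T.edgeSet} (hs : s.1 = s(a, b))
    {O : Set (Pair V)} (halg : AlgoReturns T ⊤ s ∅ ∅ O) :
    ∃ t : V → Pair V, (∀ v, 1 < T.degree v → IsSecond T par v (t v)) ∧
      ∀ S, S ∈ O ↔ ∃ v, 1 < T.degree v ∧ (S.1 = s(par v, v) ∨ S = t v) := by
  have hb : ∀ x, T.Adj a x → x = b := fun x hx => eq_of_degree_eq_one ha hx hab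
  have hpb := h.par_child hab
  obtain ⟨t, ht, hO⟩ := h.output_of_state hT.2 ha halg {v | 1 < T.degree v}
    (h.top_eq_cliqueSub hb hbi) ⟨fun v hv => hv, fun w hw _ => hw, Set.notMem_empty _, by
      intro e
      have hroot : ∀ w, 1 < T.degree w → ¬ 1 < T.degree (par w) → w = b := by
        intro w hw hpw
        have hwa : w ≠ a := by
          rintro rfl
          omega
        by_contra hwb
        refine hpw (h.degree_par hwa fun hpa => hwb (hb w (hpa ▸ h.adj w hwa)))
      constructor
      · rintro (he | rfl)
        · exact absurd he (Set.notMem_empty _)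
        · refine ⟨b, hbi, ?_, by rw [hs, hpb]⟩
          rw [hpb, Set.mem_ofPred_eq]
          omega
      · rintro ⟨w, hw, hpw, hew⟩
        obtain rfl := hroot w hw hpw
        exact Or.inr (Subtype.ext (by rw [hew, hs, hpb]))⟩
  refine ⟨t, ht, fun S => (hO S).trans ?_⟩
  constructor
  · rintro (hS | hS)
    · exact absurd hS (Set.notMem_empty _)
    · exact hS
  · exact Or.inr

end IsParent

end

/-! ### Generation of the lattice by the features of an output -/

section

open SimpleGraph Finset

variable {V : Type*} [Fintype V] {T : SimpleGraph V} [DecidableRel T.Adj]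

lemma span_eq_top_of_single_mem {κ : Type*} [Fintype κ] [DecidableEq κ]
    {W : Submodule ℤ (κ → ℤ)} (h : ∀ k, Pi.single k 1 ∈ W) : W = ⊤ := by
  refine Submodule.eq_top_iff'.2 fun x => ?_
  rw [pi_eq_sum_univ' x]
  refine W.sum_mem fun k _ => W.smul_mem _ ?_
  convert h k using 1

namespace IsParent

variable {a b : V} {par : V → V}

lemma ne_root_of_inner (ha : T.degree a = 1) {v : V} (hv : 1 < T.degree v) : v ≠ a := by
  rintro rfl
  omega

lemma covers_eq_below (ha : T.degree a = 1) {S : Pair V} {x y : V} (hS : S.1 = s(x, y))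
    (hxy : Anc par x y) (u : Inner T) : covers par S u = below a par x u := by
  obtain ⟨_, hd⟩ := S
  subst hS
  rw [covers_mk, below]
  have hu : u.1 ≠ a := ne_root_of_inner ha u.2
  by_cases h1 : Anc par u x
  · simp [h1, h1.trans hxy, hu]
  · simp [h1]

variable [DecidableEq V]

lemma feature_inl (ha : T.degree a = 1) {S : Pair V} {x y : V} (hS : S.1 = s(x, y))
    (hxy : Anc par x y) (u : Inner T) :
    feature T a b par S (.inl u) = below a par y u := by
  obtain ⟨_, hd⟩ := S
  subst hS
  change touches par ⟨s(x, y), hd⟩ u = _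
  rw [touches_mk, below]
  have hu : u.1 ≠ a := ne_root_of_inner ha u.2
  by_cases h1 : Anc par u x
  · simp [h1, h1.trans hxy, hu]
  · by_cases h2 : Anc par u y <;> simp [h1, h2, hu]

lemma feature_inr (ha : T.degree a = 1) {S : Pair V} {x y : V} (hS : S.1 = s(x, y))
    (hxy : Anc par x y) (u : Inner T) :
    feature T a b par S (.inr u) = if u.1 = b then
      (T.dist a x : ℤ) + T.dist a y - 2 * below a par x u else below a par x u := by
  have h1 := covers_eq_below ha hS hxy u
  have h2 : totalDepth T a S = T.dist a x + T.dist a y := by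
    unfold totalDepth
    rw [hS]
    rfl
  simp only [feature]
  rw [h1, h2]

/-- The feature of an edge leaving the root. -/
lemma feature_root (h : IsParent T a par) (ha : T.degree a = 1) (hab : T.Adj a b)
    (hbi : 1 < T.degree b) {S : Pair V} (hS : S.1 = s(par b, b)) :
    feature T a b par S = Pi.single (.inl ⟨b, hbi⟩) 1 + Pi.single (.inr ⟨b, hbi⟩) 1 := by
  have hpb := h.par_child hab
  have hdist : T.dist a b = 1 := dist_eq_one_iff_adj.2 hab
  funext k
  rcases k with u | u
  · rw [feature_inl ha hS (anc_par b), h.below_eq_add hab.ne', hpb, h.below_root]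
    by_cases hu : u.1 = b <;> simp [Pi.single_apply, Subtype.ext_iff, hu]
  · rw [feature_inr ha hS (anc_par b), hpb, h.below_root]
    by_cases hu : u.1 = b <;> simp [Pi.single_apply, Subtype.ext_iff, hu, hdist]

/-- The total depth grows by two. For `v = b` this is cancelled in the coordinate at `b`, because
the upper end of the edge has just come to lie below `b`. -/
lemma feature_parent_edge_sub (h : IsParent T a par) (ha : T.degree a = 1)
    (hbi : 1 < T.degree b) {v w : V} (hv : 1 < T.degree v) (hw : 1 < T.degree w)
    (hwv : par w = v) {S S' : Pair V} (hS : S.1 = s(par w, w)) (hS' : S'.1 = s(par v, v)) :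
    feature T a b par S - feature T a b par S' = Pi.single (.inl ⟨w, hw⟩) 1 +
      if v = b then 0 else Pi.single (.inr ⟨v, hv⟩) 1 + 2 • Pi.single (.inr ⟨b, hbi⟩) 1 := by
  have hwa := ne_root_of_inner ha hw
  have hva := ne_root_of_inner ha hv
  have d1 := h.dist w hwa
  have d2 := h.dist v hva
  funext k
  rcases k with u | u
  · rw [Pi.sub_apply, feature_inl ha hS (anc_par w), feature_inl ha hS' (anc_par v),
      h.below_eq_add hwa, hwv]
    by_cases hvb : v = b <;> by_cases hu : u.1 = w <;>
      simp [Pi.single_apply, Subtype.ext_iff, hu, hvb]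
  · rw [Pi.sub_apply, feature_inr ha hS (anc_par w), feature_inr ha hS' (anc_par v), hwv,
      h.below_eq_add hva]
    rw [hwv] at d1
    by_cases hvb : v = b
    · subst hvb
      by_cases hu : u.1 = v
      · simp [hu, d1, d2]; ring
      · simp [hu]
    · by_cases hu : u.1 = v
      · simp [Pi.single_apply, Subtype.ext_iff, hu, hvb]
      · by_cases hub : u.1 = b
        · have hbv : b ≠ v := fun hh => hvb hh.symm
          simp [Pi.single_apply, Subtype.ext_iff, hvb, hub, hbv, d1, d2]; ring
        · simp [Subtype.ext_iff, hu, hvb, hub]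

lemma feature_inner_second_sub (h : IsParent T a par) (ha : T.degree a = 1)
    (hbi : 1 < T.degree b) {v w : V} (hw : 1 < T.degree w)
    (hwv : par w = v) {S S' : Pair V} (hS : S.1 = s(par v, w)) (hS' : S'.1 = s(par v, v)) :
    feature T a b par S - feature T a b par S' =
      Pi.single (.inl ⟨w, hw⟩) 1 + Pi.single (.inr ⟨b, hbi⟩) 1 := by
  have hwa := ne_root_of_inner ha hw
  have d1 := h.dist w hwa
  rw [hwv] at d1
  have hanc : Anc par (par v) w := (anc_par v).trans (hwv ▸ anc_par w)
  funext k
  rcases k with u | u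
  · rw [Pi.sub_apply, feature_inl ha hS hanc, feature_inl ha hS' (anc_par v),
      h.below_eq_add hwa, hwv]
    by_cases hu : u.1 = w <;> simp [Pi.single_apply, Subtype.ext_iff, hu]
  · rw [Pi.sub_apply, feature_inr ha hS hanc, feature_inr ha hS' (anc_par v)]
    by_cases hu : u.1 = b
    · simp [Pi.single_apply, Subtype.ext_iff, hu, d1]
    · simp [Subtype.ext_iff, hu]

lemma feature_leaf_second_sub (h : IsParent T a par) (ha : T.degree a = 1)
    (hbi : 1 < T.degree b) {v l : V} (hv : 1 < T.degree v) (hvb : v ≠ b)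
    (hl : ¬ 1 < T.degree l) (hlv : par l = v) {S S' : Pair V} (hS : S.1 = s(v, l))
    (hS' : S'.1 = s(par v, v)) :
    feature T a b par S - feature T a b par S' =
      Pi.single (.inr ⟨v, hv⟩) 1 + 2 • Pi.single (.inr ⟨b, hbi⟩) 1 := by
  have hva := ne_root_of_inner ha hv
  have hla : l ≠ a := by
    rintro rfl
    exact hva (hlv.symm.trans h.root)
  have d1 := h.dist l hla
  have d2 := h.dist v hva
  rw [hlv] at d1
  have hanc : Anc par v l := hlv ▸ anc_par l
  funext k
  rcases k with u | u
  · have hul : u.1 ≠ l := fun hh => hl (hh ▸ u.2)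
    rw [Pi.sub_apply, feature_inl ha hS hanc, feature_inl ha hS' (anc_par v),
      h.below_eq_add hla, hlv]
    simp [hul]
  · rw [Pi.sub_apply, feature_inr ha hS hanc, feature_inr ha hS' (anc_par v), h.below_eq_add hva]
    by_cases hu : u.1 = v
    · simp [Pi.single_apply, Subtype.ext_iff, hu, hvb]
    · by_cases hub : u.1 = b
      · have hbv : b ≠ v := fun hh => hvb hh.symm
        simp [Pi.single_apply, Subtype.ext_iff, hub, hbv, d1, d2]; ring
      · simp [Subtype.ext_iff, hu, hub]

/-- The features of the parent edges and second pairs generate the integer lattice. -/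
theorem span_feature_eq_top (h : IsParent T a par) (ha : T.degree a = 1) (hab : T.Adj a b)
    (hbi : 1 < T.degree b) (hchild : ∃ w, 1 < T.degree w ∧ par w = b)
    {first second : Inner T → Pair V} (hf : ∀ v, (first v).1 = s(par v.1, v.1))
    (ht : ∀ v, IsSecond T par v.1 (second v)) :
    Submodule.span ℤ (Set.range fun k => feature T a b par (Sum.elim first second k)) = ⊤ := by
  set W := Submodule.span ℤ (Set.range fun k => feature T a b par (Sum.elim first second k))
  have mf : ∀ v, feature T a b par (first v) ∈ W := fun v => Submodule.subset_span ⟨.inl v, rfl⟩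
  have mt : ∀ v, feature T a b par (second v) ∈ W := fun v => Submodule.subset_span ⟨.inr v, rfl⟩
  -- As `b` has an inner child, its second pair is `{a, w}` with `w` an inner child. Its feature
  -- exceeds that of the edge `{b, w}` by exactly this unit vector.
  have mb : (Pi.single (.inr ⟨b, hbi⟩) 1 : Inner T ⊕ Inner T → ℤ) ∈ W := by
    rcases ht ⟨b, hbi⟩ with ⟨w, hw, hpw, hS⟩ | ⟨hno, -⟩
    · have e1 := h.feature_inner_second_sub ha hbi hw hpw hS (hf ⟨b, hbi⟩)
      have e2 := h.feature_parent_edge_sub ha hbi hbi hw hpw (hf ⟨w, hw⟩) (hf ⟨b, hbi⟩)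
      rw [if_pos rfl, add_zero] at e2
      rw [← e2] at e1
      rw [← sub_eq_iff_eq_add'.2 e1]
      exact W.sub_mem (W.sub_mem (mt _) (mf _)) (W.sub_mem (mf _) (mf _))
    · obtain ⟨w, hw, hpw⟩ := hchild
      exact absurd hpw (hno w hw)
  -- For either type of second pair, the covering vector at `v` results up to multiples of the one
  -- at `b`: from comparison with the edge to the inner child, or directly from the edge to a leaf.
  have mq : ∀ v : Inner T, (Pi.single (.inr v) 1 : Inner T ⊕ Inner T → ℤ) ∈ W := by
    intro v
    by_cases hvb : v.1 = b
    · have : v = ⟨b, hbi⟩ := Subtype.ext hvb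
      rwa [this]
    rcases ht v with ⟨w, hw, hpw, hS⟩ | ⟨hno, l, hpl, hS⟩
    · have e1 := h.feature_inner_second_sub ha hbi hw hpw hS (hf v)
      have e2 := h.feature_parent_edge_sub ha hbi v.2 hw hpw (hf ⟨w, hw⟩) (hf v)
      rw [if_neg hvb] at e2
      have e3 : (Pi.single (.inr v) 1 : Inner T ⊕ Inner T → ℤ) =
          (feature T a b par (first ⟨w, hw⟩) - feature T a b par (first v)) -
          (feature T a b par (second v) - feature T a b par (first v)) -
            Pi.single (.inr ⟨b, hbi⟩) 1 := by
        rw [e1, e2]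
        abel
      rw [e3]
      exact W.sub_mem (W.sub_mem (W.sub_mem (mf _) (mf _)) (W.sub_mem (mt _) (mf _))) mb
    · have e1 := h.feature_leaf_second_sub ha hbi v.2 hvb (fun hl => hno l hl hpl) hpl hS (hf v)
      rw [← sub_eq_iff_eq_add.2 e1]
      exact W.sub_mem (W.sub_mem (mt _) (mf _)) (W.smul_of_tower_mem 2 mb)
  -- Consecutive parent edges differ by a touching vector plus covering vectors that are already
  -- available.
  refine span_eq_top_of_single_mem fun k => ?_
  rcases k with v | v
  · by_cases hvb : v.1 = b
    · have : v = ⟨b, hbi⟩ := Subtype.ext hvb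
      rw [this, ← sub_eq_iff_eq_add.2 (h.feature_root ha hab hbi (hf ⟨b, hbi⟩))]
      exact W.sub_mem (mf _) mb
    · have hva := ne_root_of_inner ha v.2
      have hp : 1 < T.degree (par v) := h.degree_par hva fun hh =>
        hvb (eq_of_degree_eq_one ha (hh ▸ h.adj v hva) hab)
      have e1 := h.feature_parent_edge_sub ha hbi hp v.2 rfl (hf v) (hf ⟨par v, hp⟩)
      rw [← sub_eq_iff_eq_add.2 e1]
      refine W.sub_mem (W.sub_mem (mf _) (mf _)) ?_
      split_ifs
      · exact W.zero_mem
      · exact W.add_mem (mq _) (W.smul_of_tower_mem 2 mb)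
  · exact mq v

end IsParent

end

/-! ### The unique triple, and stars -/

section

open SimpleGraph Finset

variable {V : Type*} [Fintype V] {T : SimpleGraph V} [DecidableRel T.Adj]

namespace IsParent

variable {a b : V} {par : V → V}

/-- If the neighbour of the root has no inner child, then the tree is a star. -/
lemma exists_inner_child_of_not_isStar (h : IsParent T a par)
    (ha : T.degree a = 1) (hab : T.Adj a b) (hstar : ¬ IsStar T) :
    ∃ w, 1 < T.degree w ∧ par w = b := by
  by_contra hcon
  push Not at hcon
  have hpb := h.par_child hab
  have hall : ∀ x, x ≠ a → x = b ∨ par x = b := by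
    refine h.induction (fun hh => absurd rfl hh) fun x hx ih _ => ?_
    by_cases hpa : par x = a
    · exact Or.inl (eq_of_degree_eq_one ha (hpa ▸ h.adj x hx) hab)
    · rcases ih hpa with h1 | h1
      · exact Or.inr h1
      · exact absurd h1 (hcon _ (h.degree_par hx hpa))
  have hside : ∀ x, x ≠ a → par x = b ∨ x = b := fun x hx => (hall x hx).symm
  refine hstar ⟨b, ?_⟩
  ext x y
  rw [starGraph_adj]
  constructor
  · intro hxy
    refine ⟨hxy.ne, ?_⟩
    rcases h.eq_of_adj x y hxy with ⟨hy, rfl⟩ | ⟨hx, rfl⟩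
    · exact hside y hy
    · exact (hside x hx).symm
  · have hbadj : ∀ y, b ≠ y → T.Adj b y := by
      intro y hy
      by_cases hya : y = a
      · exact hya ▸ hab.symm
      · have h1 := (hall y hya).resolve_left hy.symm
        exact h1 ▸ h.adj y hya
    rintro ⟨hne, rfl | rfl⟩
    · exact hbadj y hne
    · exact (hbadj x hne.symm).symm

/-- The only leaf that is the parent of an inner vertex is the root. -/
lemma par_eq_root_of_degree_eq_one (h : IsParent T a par) (ha : T.degree a = 1) {v : V}
    (hv : 1 < T.degree v) (hp : T.degree (par v) = 1) : par v = a := by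
  by_contra hne
  have := h.degree_par (ne_root_of_inner ha hv) hne
  omega

/-- The ends of the triple are not adjacent, so their pair is a second pair `{par y, z}` with `z`
inner. Its leaf must be `par y`, and a leaf that is the parent of an inner vertex is the root. Hence
`y = b`, and the second pair of `b` fixes the last vertex. -/
theorem existsUnique_triple (h : IsParent T a par) (ha : T.degree a = 1) (hab : T.Adj a b) (hbi : 1 < T.degree b)
    (hchild : ∃ w, 1 < T.degree w ∧ par w = b) {t : V → Pair V}
    (ht : ∀ v, 1 < T.degree v → IsSecond T par v (t v)) {B : Finset (Pair V)}
    (hB : ∀ S, S ∈ B ↔ ∃ v, 1 < T.degree v ∧ (S.1 = s(par v, v) ∨ S = t v)) :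
    ∃! t : V × V × V,
      T.degree t.1 = 1 ∧ 1 < T.degree t.2.2 ∧ T.Adj t.1 t.2.1 ∧ T.Adj t.2.1 t.2.2 ∧
      (∃ h : ¬ s(t.1, t.2.1).IsDiag, (⟨s(t.1, t.2.1), h⟩ : Pair V) ∈ B) ∧
      (∃ h : ¬ s(t.1, t.2.2).IsDiag, (⟨s(t.1, t.2.2), h⟩ : Pair V) ∈ B) := by
  have hpb := h.par_child hab
  obtain ⟨w, hw, hpw, htw⟩ : ∃ w, 1 < T.degree w ∧ par w = b ∧ (t b).1 = s(a, w) := by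
    rcases ht b hbi with ⟨w, hw, hpw, hS⟩ | ⟨hno, -⟩
    · exact ⟨w, hw, hpw, by rw [hS, hpb]⟩
    · obtain ⟨w, hw, hpw⟩ := hchild
      exact absurd hpw (hno w hw)
  have hwa := ne_root_of_inner ha hw
  refine ⟨(a, b, w), ⟨ha, hw, hab, hpw ▸ h.adj w hwa, ⟨by simpa using hab.ne, ?_⟩,
    ⟨by simpa using hwa.symm, ?_⟩⟩, ?_⟩
  · exact (hB _).2 ⟨b, hbi, Or.inl (by rw [hpb])⟩
  · exact (hB _).2 ⟨b, hbi, Or.inr (Subtype.ext htw.symm)⟩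
  · rintro ⟨u, v, x⟩ ⟨hu, hx, huv, hvx, -, hd, hux⟩
    simp only at hu hx huv hvx hd hux
    have hnadj : ¬ T.Adj u x := fun hadj => hvx.ne (eq_of_degree_eq_one hu huv hadj)
    obtain ⟨y, hy, hS⟩ := (hB _).1 hux
    have hya := ne_root_of_inner ha hy
    have key : ∀ {p q : V}, T.Adj p q → s(u, x) ≠ s(p, q) := by
      intro p q hpq he
      refine hnadj ?_
      rw [← mem_edgeSet, he]
      exact hpq
    rcases hS with hS | hS
    · exact absurd hS (key (h.adj y hya))
    · rcases ht y hy with ⟨z, hz, hpz, hS'⟩ | ⟨-, l, hpl, hS'⟩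
      · rw [← hS] at hS'
        rcases Sym2.eq_iff.1 hS' with ⟨h1, h2⟩ | ⟨h1, -⟩
        · have hua : u = a := by
            rw [h1]
            exact h.par_eq_root_of_degree_eq_one ha hy (h1 ▸ hu)
          subst hua
          have hvb : v = b := eq_of_degree_eq_one ha huv hab
          have hyb : y = b := eq_of_degree_eq_one ha (h1.symm ▸ h.adj y hya) hab
          subst hyb
          rw [← hS] at htw
          have hxw : x = w := Sym2.congr_right.1 htw
          rw [hvb, hxw]
        · rw [h1] at hu
          omega
      · rw [← hS] at hS'
        have hla : l ≠ a := by
          rintro rfl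
          exact hya (hpl.symm.trans h.root)
        exact absurd hS' (key (hpl ▸ h.adj l hla))

end IsParent

section Star

variable [DecidableEq V]

/-- The case of a star: the features of the two pairs generate the integer lattice. -/
lemma span_feature_star {c i j k : V} (hstar : T = starGraph c) (hci : c ≠ i) (hcj : c ≠ j)
    (hck : c ≠ k) (hjk : j ≠ k) {par : V → V} (h : IsParent T i par) (hi : T.degree i = 1)
    (hc : 1 < T.degree c) (hinner : ∀ v, 1 < T.degree v → v = c) {S S' : Pair V}
    (hS : S.1 = s(c, i)) (hS' : S'.1 = s(j, k)) :
    Submodule.span ℤ (Set.range fun l => feature T i c par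
      (Sum.elim (fun _ : Inner T => S) (fun _ : Inner T => S') l)) = ⊤ := by
  have hadj : ∀ x, x ≠ c → T.Adj x c := fun x hx => by
    rw [hstar]; exact starGraph_center_adj' hx.symm
  have hic := hadj i hci.symm
  have hpc := h.par_child hic
  have hb : ∀ x, T.Adj i x → x = c := fun x hx => IsParent.eq_of_degree_eq_one hi hx hic
  have e1 := h.feature_root hi hic hc (S := S) (by rw [hS, hpc, Sym2.eq_swap])
  have hdc : T.dist i c = 1 := dist_eq_one_iff_adj.2 hic
  have hd2 : ∀ x, x ≠ c → x ≠ i → T.dist i x = 2 := by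
    intro x hxc hxi
    have hpx : par x = c := by
      by_contra hne
      have := h.adj x hxi
      rw [hstar, starGraph_adj] at this
      exact this.2.elim hne hxc
    rw [h.dist x hxi, hpx, hdc]
  -- Either the root is one of `j`, `k`, giving `0 + 2` with nothing covered, or both have depth two
  -- and `c` covers them, giving `4 - 2`. So the two features are `(1, 1)` and `(1, 2)`, a basis of
  -- `ℤ²`.
  have hcov : totalDepth T i S' - 2 * covers par S' c = 2 := by
    obtain ⟨_, hd⟩ := S'
    subst hS'
    rw [covers_mk, totalDepth_mk]
    have hni : ¬ Anc par c i := fun hh => hci (h.anc_root.1 hh)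
    by_cases hji : j = i
    · subst hji
      simp [hni, hd2 k hck.symm hjk.symm]
    · by_cases hki : k = i
      · subst hki
        simp [hni, hd2 j hcj.symm hjk]
      · simp [hd2 k hck.symm hki, hd2 j hcj.symm hji, h.anc_child hb hji, h.anc_child hb hki]
  have e2 : feature T i c par S' =
      Pi.single (.inl ⟨c, hc⟩) 1 + 2 • Pi.single (.inr ⟨c, hc⟩) 1 := by
    funext l
    rcases l with u | u
    · have hu : u = ⟨c, hc⟩ := Subtype.ext (hinner u u.2)
      subst hu
      simp [feature, h.touches_child hb]
    · have hu : u = ⟨c, hc⟩ := Subtype.ext (hinner u u.2)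
      subst hu
      simpa [feature] using hcov
  set W := Submodule.span ℤ (Set.range fun l => feature T i c par
      (Sum.elim (fun _ : Inner T => S) (fun _ : Inner T => S') l))
  have m1 : feature T i c par S ∈ W := Submodule.subset_span ⟨.inl ⟨c, hc⟩, rfl⟩
  have m2 : feature T i c par S' ∈ W := Submodule.subset_span ⟨.inr ⟨c, hc⟩, rfl⟩
  have mq : (Pi.single (.inr ⟨c, hc⟩) 1 : Inner T ⊕ Inner T → ℤ) ∈ W := by
    have : (Pi.single (.inr ⟨c, hc⟩) 1 : Inner T ⊕ Inner T → ℤ) =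
        feature T i c par S' - feature T i c par S := by
      rw [e1, e2]
      abel
    rw [this]
    exact W.sub_mem m2 m1
  refine span_eq_top_of_single_mem fun l => ?_
  rcases l with u | u
  · have hu : u = ⟨c, hc⟩ := Subtype.ext (hinner u u.2)
    rw [hu, ← sub_eq_iff_eq_add.2 e1]
    exact W.sub_mem m1 mq
  · have hu : u = ⟨c, hc⟩ := Subtype.ext (hinner u u.2)
    rwa [hu]

end Star

end

end Max4PC

/-! ### Assembly of the star and non-star cases -/

theorem mainTheorem2 {V : Type*} [Fintype V] [DecidableEq V] (T : SimpleGraph V)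
    [DecidableRel T.Adj] (hT : T.IsTree) (hn : 3 ≤ Fintype.card V)
    (B : Finset (Max4PC.Pair V)) (hB : Max4PC.IsOutput T (B : Set (Max4PC.Pair V))) :
    (¬ Max4PC.IsStar T → ∃! t : V × V × V,
      T.degree t.1 = 1 ∧ 1 < T.degree t.2.2 ∧ T.Adj t.1 t.2.1 ∧ T.Adj t.2.1 t.2.2 ∧
      (∃ h : ¬ s(t.1, t.2.1).IsDiag, (⟨s(t.1, t.2.1), h⟩ : Max4PC.Pair V) ∈ B) ∧
      (∃ h : ¬ s(t.1, t.2.2).IsDiag, (⟨s(t.1, t.2.2), h⟩ : Max4PC.Pair V) ∈ B)) ∧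
    (B.card : ℤ) = 2 * ((Fintype.card V : ℤ) - (Max4PC.numLeaves T : ℤ)) ∧
    (LinearIndependent ℝ (fun b : B => (Max4PC.max4PC T).row b.1) ∧
      Submodule.span ℝ (Set.range fun b : B => (Max4PC.max4PC T).row b.1) =
        Submodule.span ℝ (Set.range (Max4PC.max4PC T).row)) ∧
    ((Max4PC.max4PC T).submatrix (fun b : B => b.1) (fun b : B => b.1)).det =
      (-1) ^ ((Fintype.card V : ℤ) - (Max4PC.numLeaves T : ℤ)) *
        2 ^ (2 * ((Fintype.card V : ℤ) - (Max4PC.numLeaves T : ℤ) - 1)) := by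
  have : Nontrivial V := Fintype.one_lt_card_iff_nontrivial.1 (by omega)
  rcases hB with ⟨c, i, j, k, hstar, hci, hcj, hck, hjk, hB⟩ | ⟨hstar, s, ⟨a, has, ha⟩, halg⟩
  · refine ⟨fun hns => absurd ⟨c, hstar⟩ hns, ?_⟩
    obtain ⟨par, h⟩ := Max4PC.exists_isParent hT i
    have hadj : ∀ x y, T.Adj x y ↔ x ≠ y ∧ (x = c ∨ y = c) := fun x y => by
      rw [hstar, SimpleGraph.starGraph_adj]
    have hleaf : ∀ v, v ≠ c → T.degree v = 1 := by
      intro v hv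
      refine Finset.card_eq_one.2 ⟨c, ?_⟩
      ext x
      rw [SimpleGraph.mem_neighborFinset, hadj, Finset.mem_singleton]
      exact ⟨fun hx => hx.2.resolve_left hv, fun hx => ⟨hx ▸ hv, Or.inr hx⟩⟩
    have hc : 1 < T.degree c := by
      refine Finset.one_lt_card.2 ⟨j, ?_, k, ?_, hjk⟩
      · exact (T.mem_neighborFinset c j).2 ((hadj c j).2 ⟨hcj, Or.inl rfl⟩)
      · exact (T.mem_neighborFinset c k).2 ((hadj c k).2 ⟨hck, Or.inl rfl⟩)
    have hinner : ∀ v, 1 < T.degree v → v = c := by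
      intro v hv
      by_contra hne
      have := hleaf v hne
      omega
    have hi := hleaf i hci.symm
    refine Max4PC.conclusions_of_span_eq_top h hT hi ((hadj i c).2 ⟨hci.symm, Or.inr rfl⟩) hc _
      (Max4PC.span_feature_star hstar hci hcj hck hjk h hi hc hinner
        (S := ⟨s(c, i), by simpa using hci⟩) (S' := ⟨s(j, k), by simpa using hjk⟩) rfl rfl) B ?_
    rw [hB, Set.Sum.elim_range]
    have : Nonempty (Max4PC.Inner T) := ⟨⟨c, hc⟩⟩
    rw [Set.range_const, Set.range_const]
    rfl
  · obtain ⟨par, h⟩ := Max4PC.exists_isParent hT a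
    obtain ⟨b, hab, hsab⟩ := Max4PC.exists_edge_eq has
    have hbi := h.inner_child hn hT.1 ha hab
    have hchild := h.exists_inner_child_of_not_isStar ha hab hstar
    obtain ⟨t, ht, hO⟩ := h.output_eq hT ha hab hbi hsab halg
    refine ⟨fun _ => h.existsUnique_triple ha hab hbi hchild ht hO, ?_⟩
    let first : Max4PC.Inner T → Max4PC.Pair V := fun v => ⟨s(par v, v), by
      simpa using (h.adj v (Max4PC.IsParent.ne_root_of_inner ha v.2)).ne⟩
    refine Max4PC.conclusions_of_span_eq_top h hT ha hab hbi _
      (h.span_feature_eq_top ha hab hbi hchild (first := first) (second := fun v => t v)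
        (fun _ => rfl) fun v => ht v v.2) B ?_
    ext S
    rw [hO, Set.Sum.elim_range]
    constructor
    · rintro ⟨v, hv, hS | hS⟩
      · exact Or.inl ⟨⟨v, hv⟩, Subtype.ext hS.symm⟩
      · exact Or.inr ⟨⟨v, hv⟩, hS.symm⟩
    · rintro (⟨v, rfl⟩ | ⟨v, rfl⟩)
      · exact ⟨v, v.2, Or.inl rfl⟩
      · exact ⟨v, v.2, Or.inr rfl⟩
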